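/- All vector spaces are real. For a finite-dimensional vector space $V$ write $\lambda(V)=\Lambda^{\mathrm{top}}V$, $\lambda^*(V)=\lambda(V)^*$, and let $\mathcal P:\lambda(V^*)\to\lambda^*(V)$ be the isomorphism $$\{\mathcal P(\alpha_1\wedge\dots\wedge\alpha_n)\}(v_1\wedge\dots\wedge v_n)=(-1)^{\binom n2}\det\big(\alpha_i(v_j)\big)_{i,j=1}^n ;$$ its inverse is also denoted by $\mathcal P$. For a nonzero element $\ell$ of a line, $\ell^*$ is the functional on the line with $\ell^*(\ell)=1$. For a short exact sequence $0\to V'\stackrel{i}{\to}V\stackrel{j}{\to}V''\to0$ of finite-dimensional spaces let $\wedge:\lambda(V')\otimes\lambda(V'')\to\lambda(V)$ be the isomorphism $v_1'\wedge\dots\wedge v_k'\otimes j(v_1)\wedge\dots\wedge j(v_\ell)\mapsto i(v_1')\wedge\dots\wedge i(v_k')\wedge v_1\wedge\dots\wedge v_\ell$, for bases $(v_i')$ of $V'$ and $(j(v_i))$ of $V''$. For a Fredholm operator $D:X\to Y$ between Banach spaces (bounded, with closed image and finite-dimensional kernel and cokernel) let $\kappa(D)=\ker D$, $\mathfrak c(D)=Y/\mathrm{Im}\,D$,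 $\mathrm{ind}\,D=\dim\kappa(D)-\dim\mathfrak c(D)$ and $\lambda(D)=\lambda(\kappa(D))\otimes\lambda^*(\mathfrak c(D))$. Let $D^*:Y^*\to X^*$ be the dual operator on the spaces of bounded functionals; it is Fredholm. The maps $$\mathcal D_D:\kappa(D)\to\mathfrak c(D^*)^*,\ \{\mathcal D_D(x)\}(\alpha+\mathrm{Im}\,D^*)=\alpha(x),\qquad \mathcal D_D:\mathfrak c(D)^*\to\kappa(D^*),\ \{\mathcal D_D(\beta)\}(y)=\beta(y+\mathrm{Im}\,D),$$ are isomorphisms. Define the dualization isomorphism $$\widetilde{\mathcal D}_D:\lambda(D)\to\lambda(D^*),\qquad x\otimes\alpha\mapsto(-1)^{(\mathrm{ind}\,D)\dim\mathfrak c(D)}\,\lambda(\mathcal D_D)(\mathcal P\alpha)\otimes\mathcal P\big(\lambda(\mathcal D_D)x\big).$$ For Fredholm operators $D_1,D_2$ let $R:\lambda(D_1)\otimes\lambda(D_2)\to\lambda(D_2)\otimes\lambda(D_1)$ be $R(z_1\otimes z_2)=(-1)^{(\mathrm{ind}\,D_1)(\mathrm{ind}\,D_2)}z_2\otimes z_1$.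 An exact triple $\mathfrak t$ of Fredholm operators consists of Fredholm operators $D':X'\to Y'$, $D:X\to Y$, $D'':X''\to Y''$ between Banach spaces and exact sequences $0\to X'\stackrel{i_X}{\to}X\stackrel{j_X}{\to}X''\to0$ and $0\to Y'\stackrel{i_Y}{\to}Y\stackrel{j_Y}{\to}Y''\to0$ of bounded operators with $Di_X=i_YD'$ and $D''j_X=j_YD$. Let $$0\to\kappa(D')\stackrel{i_X}{\to}\kappa(D)\stackrel{j_X}{\to}\kappa(D'')\stackrel{\delta}{\to}\mathfrak c(D')\stackrel{i_Y}{\to}\mathfrak c(D)\stackrel{j_Y}{\to}\mathfrak c(D'')\to0$$ be the exact sequence of the Snake Lemma, where $\delta(x'')=y'+\mathrm{Im}\,D'$ if $j_Xx=x''$ and $i_Yy'=Dx$. Let $\epsilon_{\mathfrak t}=(\mathrm{ind}\,D'')\dim\mathfrak c(D')+\dim\mathfrak c(D)\cdot\dim\mathrm{Im}\,\delta$, and let $\Psi_{\mathfrak t}:\lambda(D')\otimes\lambda(D'')\to\lambda(D)$ be the isomorphism $$\Psi_{\mathfrak t}\big(x\otimes(v\wedge w)^*\otimes(u\wedge v)\otimes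 y^*\big)=(-1)^{\epsilon_{\mathfrak t}}(x\wedge u)\otimes(w\wedge y)^*$$ for nonzero $x\in\lambda(\kappa(D'))$, $u\in\lambda(\mathrm{Im}\,j_X)$, $v\in\lambda(\mathrm{Im}\,\delta)$, $w\in\lambda(\mathrm{Im}\,i_Y)$, $y\in\lambda(\mathfrak c(D''))$, where $\mathrm{Im}\,j_X\subset\kappa(D'')$ and $\mathrm{Im}\,i_Y\subset\mathfrak c(D)$ are images in the above sequence and $\wedge$ refers to the four short exact sequences into which it splits. The dual triple $\mathfrak t^*$ is the exact triple with operators $D''^*,D^*,D'^*$ and rows $0\to Y''^*\stackrel{j_Y^*}{\to}Y^*\stackrel{i_Y^*}{\to}Y'^*\to0$ and $0\to X''^*\stackrel{j_X^*}{\to}X^*\stackrel{i_X^*}{\to}X'^*\to0$. **Proposition (Dual Exact Triples).** For every exact triple $\mathfrak t$ of Fredholm operators as above, $$\widetilde{\mathcal D}_D\circ\Psi_{\mathfrak t}=\Psi_{\mathfrak t^*}\circ\big(\widetilde{\mathcal D}_{D''}\otimes\widetilde{\mathcal D}_{D'}\big)\circ R:\ \lambda(D')\otimes\lambda(D'')\to\lambda(D^*).$$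 -/

import Mathlib

open Module
open scoped TensorProduct

noncomputable section

namespace FredholmDet

section Lines

variable {V V' V'' W : Type*}
  [AddCommGroup V] [Module ℝ V] [AddCommGroup V'] [Module ℝ V']
  [AddCommGroup V''] [Module ℝ V''] [AddCommGroup W] [Module ℝ W]

/-- Multiplication by the sign `(-1) ^ m`. -/
def signEquiv (W : Type*) [AddCommMonoid W] [Module ℝ W] (m : ℤ) : W ≃ₗ[ℝ] W :=
  LinearEquiv.smulOfUnit (Units.mk0 ((-1 : ℝ) ^ m) (zpow_ne_zero m (by norm_num)))

@[simp]
theorem signEquiv_apply (W : Type*) [AddCommMonoid W] [Module ℝ W] (m : ℤ) (x : W) : signEquiv W m x = ((-1 : ℝ) ^ m) • x := rfl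

/-- The top exterior power `λ(V)` of a finite-dimensional real vector space. -/
abbrev TopExt (V : Type*) [AddCommGroup V] [Module ℝ V] : Type _ :=
  ⋀[ℝ]^(finrank ℝ V) V

/-- Exterior powers of equal degrees are equal. -/
def powCast (V : Type*) [AddCommGroup V] [Module ℝ V] {m n : ℕ} (h : m = n) :
    ⋀[ℝ]^m V ≃ₗ[ℝ] ⋀[ℝ]^n V :=
  LinearEquiv.ofEq _ _ (by rw [h])

@[simp]
theorem coe_powCast {m n : ℕ} (h : m = n) (x : ⋀[ℝ]^m V) :
    (powCast V h x : ExteriorAlgebra ℝ V) = x := rfl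

/-- The element `v₁ ∧ … ∧ vₙ` of `λ(V)`, where `n = dim V`. -/
def topWedge {n : ℕ} (h : n = finrank ℝ V) (v : Fin n → V) : TopExt V :=
  powCast V h (exteriorPower.ιMulti ℝ n v)

/-- The isomorphism `⋀ⁿ V → ⋀ⁿ W` induced by an isomorphism `e : V → W`. -/
def powMap (n : ℕ) (e : V ≃ₗ[ℝ] W) : ⋀[ℝ]^n V ≃ₗ[ℝ] ⋀[ℝ]^n W :=
  LinearEquiv.ofLinearMap (σ₁₂ := RingHom.id ℝ) (σ₂₁ := RingHom.id ℝ)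
    (exteriorPower.map n (e : V →ₗ[ℝ] W))
    (exteriorPower.map n (e.symm : W →ₗ[ℝ] V))
    (by rw [← exteriorPower.map_comp]; simp)
    (by rw [← exteriorPower.map_comp]; simp)

/-- The isomorphism `λ(e) : λ(V) → λ(W)` induced by an isomorphism `e : V → W`. -/
def topMap (e : V ≃ₗ[ℝ] W) : TopExt V ≃ₗ[ℝ] TopExt W :=
  powMap (finrank ℝ V) e ≪≫ₗ powCast W e.finrank_eq

theorem topMap_topWedge (e : V ≃ₗ[ℝ] W) {n : ℕ} (h : n = finrank ℝ V) (v : Fin n → V) :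
    topMap e (topWedge h v) = topWedge (h.trans e.finrank_eq) (e ∘ v) := by
  subst h
  exact congrArg (powCast W e.finrank_eq)
    (exteriorPower.map_apply_ιMulti (R := ℝ) (e : V →ₗ[ℝ] W) v)

theorem finrank_topExt (V : Type*) [AddCommGroup V] [Module ℝ V] [FiniteDimensional ℝ V] :
    finrank ℝ (TopExt V) = 1 := by
  rw [exteriorPower.finrank_eq, Nat.choose_self]

theorem topWedge_basis_ne_zero {n : ℕ} (b : Basis (Fin n) ℝ V) (h : n = finrank ℝ V) :
    topWedge h b ≠ 0 := by
  subst h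
  intro h0
  have h1 : exteriorPower.ιMulti ℝ _ b = 0 := h0
  have h2 := exteriorPower.alternatingMapLinearEquiv_apply_ιMulti b.det b
  rw [h1, map_zero, b.det_self] at h2
  exact zero_ne_one h2

/-- A nonzero linear map between lines is injective. -/
theorem line_injective {L M : Type*} [AddCommGroup L] [Module ℝ L] [AddCommGroup M] [Module ℝ M]
    (hL : finrank ℝ L = 1) (f : L →ₗ[ℝ] M) {x : L} (hx : f x ≠ 0) :
    Function.Injective f := by
  have hx0 : x ≠ 0 := fun h => hx (by rw [h, map_zero])
  refine (injective_iff_map_eq_zero f).2 fun y hy => ?_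
  obtain ⟨c, rfl⟩ := (finrank_eq_one_iff_of_nonzero' x hx0).1 hL y
  rw [map_smul, smul_eq_zero] at hy
  rcases hy with rfl | hy
  · exact zero_smul _ _
  · exact absurd hy hx

/-- A nonzero linear map between lines is bijective. -/
theorem line_bijective {L M : Type*} [AddCommGroup L] [Module ℝ L] [AddCommGroup M] [Module ℝ M]
    (hL : finrank ℝ L = 1) (hM : finrank ℝ M = 1) (f : L →ₗ[ℝ] M) {x : L} (hx : f x ≠ 0) :
    Function.Bijective f := by
  refine ⟨line_injective hL f hx, fun y => ?_⟩
  obtain ⟨c, hc⟩ := (finrank_eq_one_iff_of_nonzero' (f x) hx).1 hM y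
  exact ⟨c • x, by rw [map_smul, hc]⟩

/-- Functionals on a line that take the value `1` at the same vector are equal. -/
theorem line_dual_ext {L : Type*} [AddCommGroup L] [Module ℝ L] (hL : finrank ℝ L = 1)
    {φ ψ : Dual ℝ L} {x : L} (hφ : φ x = 1) (hψ : ψ x = 1) : φ = ψ := by
  have hx : x ≠ 0 := fun h => by rw [h, map_zero] at hφ; exact zero_ne_one hφ
  refine LinearMap.ext fun y => ?_
  obtain ⟨c, rfl⟩ := (finrank_eq_one_iff_of_nonzero' x hx).1 hL y
  rw [map_smul, map_smul, hφ, hψ]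

/-- A nonzero vector has a functional that takes the value `1` at it. -/
theorem exists_dual_eq_one {L : Type*} [AddCommGroup L] [Module ℝ L] {x : L} (hx : x ≠ 0) :
    ∃ φ : Dual ℝ L, φ x = 1 := by
  obtain ⟨β, hβ⟩ : ∃ β : Dual ℝ L, β x ≠ 0 := by
    by_contra! h
    exact hx ((Module.forall_dual_apply_eq_zero_iff ℝ x).1 h)
  exact ⟨(β x)⁻¹ • β, inv_mul_cancel₀ hβ⟩

/-- The evaluation isomorphism `L ⊗ L* → ℝ` of a line `L`. -/
def lineEval (L : Type*) [AddCommGroup L] [Module ℝ L] (hL : finrank ℝ L = 1) :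
    L ⊗[ℝ] Dual ℝ L ≃ₗ[ℝ] ℝ :=
  LinearEquiv.ofBijective (contractRight ℝ L) (by
      have : FiniteDimensional ℝ L := FiniteDimensional.of_finrank_eq_succ hL
      have hne : Nontrivial L := nontrivial_of_finrank_eq_succ hL
      obtain ⟨x, hx⟩ := exists_ne (0 : L)
      obtain ⟨β, hβ⟩ := exists_dual_eq_one hx
      refine line_bijective ?_ (finrank_self ℝ) _ (x := x ⊗ₜ β) (hβ.trans_ne one_ne_zero)
      rw [finrank_tensorProduct, Subspace.dual_finrank_eq, hL])

@[simp]
theorem lineEval_tmul (L : Type*) [AddCommGroup L] [Module ℝ L] (hL : finrank ℝ L = 1)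
    (v : L) (α : Dual ℝ L) : lineEval L hL (v ⊗ₜ α) = α v := rfl

/-- The contraction isomorphism `(A ⊗ L) ⊗ (L* ⊗ C) → A ⊗ C` for a line `L`. -/
def contractMiddle (A L C : Type*) [AddCommGroup A] [Module ℝ A] [AddCommGroup L] [Module ℝ L]
    [AddCommGroup C] [Module ℝ C] (hL : finrank ℝ L = 1) :
    (A ⊗[ℝ] L) ⊗[ℝ] (Dual ℝ L ⊗[ℝ] C) ≃ₗ[ℝ] A ⊗[ℝ] C :=
  TensorProduct.assoc ℝ A L (Dual ℝ L ⊗[ℝ] C) ≪≫ₗ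
    TensorProduct.congr (LinearEquiv.refl ℝ A)
      ((TensorProduct.assoc ℝ L (Dual ℝ L) C).symm ≪≫ₗ
        TensorProduct.congr (lineEval L hL) (LinearEquiv.refl ℝ C) ≪≫ₗ
        TensorProduct.lid ℝ C)

@[simp]
theorem contractMiddle_tmul (A L C : Type*) [AddCommGroup A] [Module ℝ A] [AddCommGroup L]
    [Module ℝ L] [AddCommGroup C] [Module ℝ C] (hL : finrank ℝ L = 1)
    (a : A) (v : L) (β : Dual ℝ L) (c : C) :
    contractMiddle A L C hL ((a ⊗ₜ v) ⊗ₜ (β ⊗ₜ c)) = β v • (a ⊗ₜ[ℝ] c) := by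
  simp [contractMiddle]

/-- The product `⋀ᵖ V × ⋀^q V → ⋀^(p+q) V` of the exterior algebra. -/
def extMul (V : Type*) [AddCommGroup V] [Module ℝ V] (p q : ℕ) :
    ⋀[ℝ]^p V →ₗ[ℝ] ⋀[ℝ]^q V →ₗ[ℝ] ⋀[ℝ]^(p + q) V :=
  LinearMap.mk₂ ℝ
    (fun a b => ⟨(a : ExteriorAlgebra ℝ V) * b, by
      change _ ∈ LinearMap.range (ExteriorAlgebra.ι ℝ (M := V)) ^ (p + q)
      rw [pow_add]; exact Submodule.mul_mem_mul a.2 b.2⟩)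
    (fun a a' b => Subtype.ext (by simp [add_mul]))
    (fun c a b => Subtype.ext (by simp))
    (fun a b b' => Subtype.ext (by simp [mul_add]))
    (fun c a b => Subtype.ext (by simp))

theorem extMul_ιMulti {p q : ℕ} (x : Fin p → V) (y : Fin q → V) :
    extMul V p q (exteriorPower.ιMulti ℝ p x) (exteriorPower.ιMulti ℝ q y) =
      exteriorPower.ιMulti ℝ (p + q) (Fin.append x y) := by
  apply Subtype.ext
  change ExteriorAlgebra.ιMulti ℝ p x * ExteriorAlgebra.ιMulti ℝ q y =
    ExteriorAlgebra.ιMulti ℝ (p + q) (Fin.append x y)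
  simp only [ExteriorAlgebra.ιMulti_apply]
  rw [← List.prod_append, ← List.ofFn_fin_append]
  congr 2
  funext i
  refine Fin.addCases (fun i => ?_) (fun i => ?_) i <;> simp

/-- A linear section of a surjective linear map. -/
def rightSection (g : V →ₗ[ℝ] V'') (hg : Function.Surjective g) : V'' →ₗ[ℝ] V :=
  Classical.choose (g.exists_rightInverse_of_surjective (LinearMap.range_eq_top.2 hg))

theorem apply_section (g : V →ₗ[ℝ] V'') (hg : Function.Surjective g) (y : V'') :
    g (rightSection g hg y) = y :=
  LinearMap.congr_fun
    (Classical.choose_spec (g.exists_rightInverse_of_surjective (LinearMap.range_eq_top.2 hg))) y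

variable {f : V' →ₗ[ℝ] V} {g : V →ₗ[ℝ] V''}

/-- The splitting of a short exact sequence by the chosen section. -/
def splitEquiv (hf : Function.Injective f) (hfg : Function.Exact f g)
    (hg : Function.Surjective g) : (V' × V'') ≃ₗ[ℝ] V :=
  LinearEquiv.ofBijective (f.coprod (rightSection g hg)) (by
    constructor
    · refine (injective_iff_map_eq_zero _).2 ?_
      rintro ⟨a, b⟩ h
      rw [LinearMap.coprod_apply] at h
      have hb : b = 0 := by
        have := congrArg g h
        simpa [apply_section, hfg.apply_apply_eq_zero] using this
      subst hb
      have ha : f a = f 0 := by simpa using h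
      rw [hf ha]; rfl
    · intro y
      have : g (y - rightSection g hg (g y)) = 0 := by simp [apply_section]
      obtain ⟨a, ha⟩ := (hfg _).1 this
      exact ⟨(a, g y), by simp [ha]⟩)

theorem splitEquiv_apply (hf : Function.Injective f) (hfg : Function.Exact f g)
    (hg : Function.Surjective g) (p : V' × V'') :
    splitEquiv hf hfg hg p = f p.1 + rightSection g hg p.2 := rfl

theorem finrank_add_eq [FiniteDimensional ℝ V] (hf : Function.Injective f)
    (hfg : Function.Exact f g) (hg : Function.Surjective g) :
    finrank ℝ V' + finrank ℝ V'' = finrank ℝ V := by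
  have : FiniteDimensional ℝ V' := FiniteDimensional.of_injective f hf
  have : FiniteDimensional ℝ V'' := Module.Finite.of_surjective g hg
  rw [← (splitEquiv hf hfg hg).finrank_eq, finrank_prod]

/-- The linear map `λ(V') ⊗ λ(V'') → λ(V)`, `x ⊗ y ↦ λ(f)x ∧ λ(s)y`, of a short exact sequence
`0 → V' → V → V'' → 0` with maps `f`, `g`, where `s` is a linear section of `g`. -/
def wedgeMap [FiniteDimensional ℝ V] (hf : Function.Injective f)
    (hfg : Function.Exact f g) (hg : Function.Surjective g) :
    TopExt V' ⊗[ℝ] TopExt V'' →ₗ[ℝ] TopExt V :=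
  (powCast V (finrank_add_eq hf hfg hg)).toLinearMap ∘ₗ
    TensorProduct.lift ((extMul V (finrank ℝ V') (finrank ℝ V'')).compl₁₂
      (exteriorPower.map _ f) (exteriorPower.map _ (rightSection g hg)))

theorem wedgeMap_section [FiniteDimensional ℝ V] (hf : Function.Injective f)
    (hfg : Function.Exact f g) (hg : Function.Surjective g) {m n : ℕ}
    (hm : m = finrank ℝ V') (hn : n = finrank ℝ V'') (x : Fin m → V') (y : Fin n → V'') :
    wedgeMap hf hfg hg (topWedge hm x ⊗ₜ topWedge hn y) =
      topWedge (by rw [hm, hn, finrank_add_eq hf hfg hg])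
        (Fin.append (f ∘ x) (rightSection g hg ∘ y)) := by
  subst hm hn
  have h := extMul_ιMulti (f ∘ x) (rightSection g hg ∘ y)
  rw [← exteriorPower.map_apply_ιMulti, ← exteriorPower.map_apply_ιMulti] at h
  exact congrArg (powCast V (finrank_add_eq hf hfg hg)) h

theorem wedgeMap_bijective [FiniteDimensional ℝ V] (hf : Function.Injective f)
    (hfg : Function.Exact f g) (hg : Function.Surjective g) :
    Function.Bijective (wedgeMap hf hfg hg) := by
  have : FiniteDimensional ℝ V' := FiniteDimensional.of_injective f hf
  have : FiniteDimensional ℝ V'' := Module.Finite.of_surjective g hg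
  refine line_bijective (by rw [finrank_tensorProduct, finrank_topExt, finrank_topExt])
    (finrank_topExt V)
    (wedgeMap hf hfg hg)
    (x := topWedge rfl (finBasis ℝ V') ⊗ₜ topWedge rfl (finBasis ℝ V'')) ?_
  rw [wedgeMap_section]
  have : Fin.append (f ∘ finBasis ℝ V') (rightSection g hg ∘ finBasis ℝ V'') =
      ((((finBasis ℝ V').prod (finBasis ℝ V'')).map (splitEquiv hf hfg hg)).reindex
        finSumFinEquiv) := by
    funext i
    refine Fin.addCases (fun i => ?_) (fun i => ?_) i
    · simp [splitEquiv_apply]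
    · simp [splitEquiv_apply]
  rw [this]
  exact topWedge_basis_ne_zero _ _

/-- The isomorphism `∧ : λ(V') ⊗ λ(V'') → λ(V)` of a short exact sequence
`0 → V' → V → V'' → 0` of finite-dimensional spaces; it does not depend on the section
used to write it down, see `wedge_topWedge`. -/
def wedge [FiniteDimensional ℝ V] (hf : Function.Injective f)
    (hfg : Function.Exact f g) (hg : Function.Surjective g) :
    TopExt V' ⊗[ℝ] TopExt V'' ≃ₗ[ℝ] TopExt V :=
  LinearEquiv.ofBijective (wedgeMap hf hfg hg) (wedgeMap_bijective hf hfg hg)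

/-- `(x₁ ∧ … ∧ xₘ) ⊗ (g u₁ ∧ … ∧ g uₙ) ↦ f x₁ ∧ … ∧ f xₘ ∧ u₁ ∧ … ∧ uₙ`
for every basis `x` of `V'` and all `u₁, …, uₙ` in `V`. -/
theorem wedge_topWedge [FiniteDimensional ℝ V] (hf : Function.Injective f)
    (hfg : Function.Exact f g) (hg : Function.Surjective g) {m n : ℕ}
    (hm : m = finrank ℝ V') (hn : n = finrank ℝ V'') (x : Basis (Fin m) ℝ V') (u : Fin n → V) :
    wedge hf hfg hg (topWedge hm x ⊗ₜ topWedge hn (g ∘ u)) =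
      topWedge (by rw [hm, hn, finrank_add_eq hf hfg hg]) (Fin.append (f ∘ x) u) := by
  change wedgeMap hf hfg hg _ = _
  rw [wedgeMap_section]
  let Φ : MultilinearMap ℝ (fun _ : Fin n => V) (⋀[ℝ]^(m + n) V) :=
    (extMul V m n (exteriorPower.ιMulti ℝ m (f ∘ x))).compMultilinearMap
      (exteriorPower.ιMulti ℝ n).toMultilinearMap
  have hΦ : ∀ w : Fin n → V, Φ w = exteriorPower.ιMulti ℝ (m + n) (Fin.append (f ∘ x) w) :=
    fun w => extMul_ιMulti _ _
  have hzero : ∀ (w : Fin n → V) (i : Fin n), w i ∈ LinearMap.range f → Φ w = 0 := by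
    rintro w i ⟨a, ha⟩
    rw [hΦ]
    refine AlternatingMap.map_linearDependent _ _ fun hli => ?_
    refine hli.notMem_span_image (s := Set.range (Fin.castAdd n)) (x := Fin.natAdd m i) ?_ ?_
    · rintro ⟨j, hj⟩
      have := congrArg Fin.val hj
      simp only [Fin.val_castAdd, Fin.val_natAdd] at this
      omega
    · rw [Fin.append_right, ← ha, ← Set.range_comp]
      have : Fin.append (f ∘ x) w ∘ Fin.castAdd n = f ∘ x := by funext j; simp
      rw [this, Set.range_comp, ← Submodule.map_span, x.span_eq]
      exact Submodule.mem_map_of_mem trivial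
  have key : Φ u = Φ (rightSection g hg ∘ g ∘ u) := by
    have hu : u = rightSection g hg ∘ g ∘ u + (u - rightSection g hg ∘ g ∘ u) := by simp
    conv_lhs => rw [hu, MultilinearMap.map_add_univ]
    rw [Finset.sum_eq_single Finset.univ, Finset.piecewise_univ]
    · intro s _ hs
      obtain ⟨i, hi⟩ : ∃ i, i ∉ s := by
        by_contra! h
        exact hs (Finset.eq_univ_iff_forall.2 h)
      refine hzero _ i ?_
      rw [Finset.piecewise_eq_of_notMem _ _ _ hi]
      refine (hfg _).1 ?_
      simp [apply_section]
    · simp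
  rw [hΦ, hΦ] at key
  exact congrArg (powCast V _) key.symm

theorem signed_pairing_bijective (V : Type*) [AddCommGroup V] [Module ℝ V]
    [FiniteDimensional ℝ V] :
    Function.Bijective
      (((-1 : ℝ) ^ (finrank ℝ V).choose 2) •
        (exteriorPower.pairingDual ℝ V (finrank ℝ V) ∘ₗ
          (powCast (Dual ℝ V) (Subspace.dual_finrank_eq (K := ℝ) (V := V))).toLinearMap)) := by
  refine line_bijective (finrank_topExt _)
    ((Subspace.dual_finrank_eq (K := ℝ) (V := TopExt V)).trans (finrank_topExt V)) _
    (x := topWedge (Subspace.dual_finrank_eq).symm (finBasis ℝ V).dualBasis) fun h => ?_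
  have h1 := LinearMap.congr_fun h (exteriorPower.ιMulti ℝ _ (finBasis ℝ V))
  have h2 : exteriorPower.pairingDual ℝ V _ (exteriorPower.ιMulti ℝ _ (finBasis ℝ V).dualBasis)
      (exteriorPower.ιMulti ℝ _ (finBasis ℝ V)) = 1 := by
    rw [exteriorPower.pairingDual_ιMulti_ιMulti, ← Matrix.det_one (n := Fin (finrank ℝ V))]
    congr 1
    ext i j
    simp [Matrix.one_apply, Finsupp.single_apply]
  have h3 : ((-1 : ℝ) ^ (finrank ℝ V).choose 2) *
      exteriorPower.pairingDual ℝ V _ (exteriorPower.ιMulti ℝ _ (finBasis ℝ V).dualBasis)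
      (exteriorPower.ιMulti ℝ _ (finBasis ℝ V)) = 0 := h1
  rw [h2, mul_one] at h3
  exact pow_ne_zero _ (by norm_num) h3

/-- The isomorphism `𝒫 : λ(V*) → λ(V)*`,
`𝒫(α₁ ∧ … ∧ αₙ)(v₁ ∧ … ∧ vₙ) = (-1)^(n choose 2) det (αᵢ(vⱼ))`. -/
def pairing (V : Type*) [AddCommGroup V] [Module ℝ V] [FiniteDimensional ℝ V] :
    TopExt (Dual ℝ V) ≃ₗ[ℝ] Dual ℝ (TopExt V) :=
  LinearEquiv.ofBijective
    (((-1 : ℝ) ^ (finrank ℝ V).choose 2) •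
      (exteriorPower.pairingDual ℝ V (finrank ℝ V) ∘ₗ
        (powCast (Dual ℝ V) (Subspace.dual_finrank_eq (K := ℝ) (V := V))).toLinearMap))
    (signed_pairing_bijective V)

theorem pairing_topWedge [FiniteDimensional ℝ V] {n : ℕ} (h : n = finrank ℝ V)
    (α : Fin n → Dual ℝ V) (v : Fin n → V) :
    pairing V (topWedge (h.trans Subspace.dual_finrank_eq.symm) α) (topWedge h v) =
      (-1 : ℝ) ^ n.choose 2 * (Matrix.of fun i j => α i (v j)).det := by
  subst h
  rw [← Matrix.det_transpose]
  exact congrArg (fun r => (-1 : ℝ) ^ (finrank ℝ V).choose 2 * r)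
    (exteriorPower.pairingDual_ιMulti_ιMulti α v)

/-- Given isomorphisms `K' ⊗ J ≅ K`, `J ⊗ L ≅ K''`, `L ⊗ I ≅ C'`, `I ⊗ C'' ≅ C` of lines, the
isomorphism `(K' ⊗ C'*) ⊗ (K'' ⊗ C''*) → K ⊗ C*` composed of
`K' ⊗ K'' ≅ K' ⊗ (J ⊗ L) ≅ K ⊗ L`, `C'* ⊗ C''* ≅ (L* ⊗ I*) ⊗ C''* ≅ L* ⊗ C*` and the evaluation
`L ⊗ L* ≅ ℝ`; see `lineTriple_apply`. -/
def lineTriple {K' K K'' J L I C' C C'' : Type*} [AddCommGroup K'] [Module ℝ K']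
    [AddCommGroup K] [Module ℝ K] [AddCommGroup K''] [Module ℝ K''] [AddCommGroup J] [Module ℝ J]
    [AddCommGroup L] [Module ℝ L] [AddCommGroup I] [Module ℝ I] [AddCommGroup C'] [Module ℝ C']
    [AddCommGroup C] [Module ℝ C] [AddCommGroup C''] [Module ℝ C'']
    [FiniteDimensional ℝ L] [FiniteDimensional ℝ I] [FiniteDimensional ℝ C'']
    (hL : finrank ℝ L = 1) (eK : K' ⊗[ℝ] J ≃ₗ[ℝ] K) (eK'' : J ⊗[ℝ] L ≃ₗ[ℝ] K'')
    (eC' : L ⊗[ℝ] I ≃ₗ[ℝ] C') (eC : I ⊗[ℝ] C'' ≃ₗ[ℝ] C) :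
    (K' ⊗[ℝ] Dual ℝ C') ⊗[ℝ] (K'' ⊗[ℝ] Dual ℝ C'') ≃ₗ[ℝ] K ⊗[ℝ] Dual ℝ C :=
  TensorProduct.tensorTensorTensorComm ℝ K' (Dual ℝ C') K'' (Dual ℝ C'') ≪≫ₗ
    TensorProduct.congr
      (TensorProduct.congr (LinearEquiv.refl ℝ K') eK''.symm ≪≫ₗ
        (TensorProduct.assoc ℝ K' J L).symm ≪≫ₗ
        TensorProduct.congr eK (LinearEquiv.refl ℝ L))
      (TensorProduct.congr (eC'.dualMap ≪≫ₗ (TensorProduct.dualDistribEquiv ℝ L I).symm)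
          (LinearEquiv.refl ℝ (Dual ℝ C'')) ≪≫ₗ
        TensorProduct.assoc ℝ (Dual ℝ L) (Dual ℝ I) (Dual ℝ C'') ≪≫ₗ
        TensorProduct.congr (LinearEquiv.refl ℝ (Dual ℝ L))
          (TensorProduct.dualDistribEquiv ℝ I C'' ≪≫ₗ eC.symm.dualMap)) ≪≫ₗ
    contractMiddle K L (Dual ℝ C) hL

theorem lineTriple_apply {K' K K'' J L I C' C C'' : Type*} [AddCommGroup K'] [Module ℝ K']
    [AddCommGroup K] [Module ℝ K] [AddCommGroup K''] [Module ℝ K''] [AddCommGroup J] [Module ℝ J]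
    [AddCommGroup L] [Module ℝ L] [AddCommGroup I] [Module ℝ I] [AddCommGroup C'] [Module ℝ C']
    [AddCommGroup C] [Module ℝ C] [AddCommGroup C''] [Module ℝ C'']
    [FiniteDimensional ℝ L] [FiniteDimensional ℝ I] [FiniteDimensional ℝ C'']
    (hL : finrank ℝ L = 1) (hC' : finrank ℝ C' = 1) (hC : finrank ℝ C = 1)
    (eK : K' ⊗[ℝ] J ≃ₗ[ℝ] K) (eK'' : J ⊗[ℝ] L ≃ₗ[ℝ] K'')
    (eC' : L ⊗[ℝ] I ≃ₗ[ℝ] C') (eC : I ⊗[ℝ] C'' ≃ₗ[ℝ] C)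
    (x : K') (u : J) (v : L) (w : I) (y : C'') (α : Dual ℝ C') (γ : Dual ℝ C'') (ω : Dual ℝ C)
    (hα : α (eC' (v ⊗ₜ w)) = 1) (hγ : γ y = 1) (hω : ω (eC (w ⊗ₜ y)) = 1) :
    lineTriple hL eK eK'' eC' eC ((x ⊗ₜ α) ⊗ₜ (eK'' (u ⊗ₜ v) ⊗ₜ γ)) =
      eK (x ⊗ₜ u) ⊗ₜ[ℝ] ω := by
  have hvw : v ⊗ₜ[ℝ] w ≠ 0 := fun h => by
    rw [h, map_zero, map_zero] at hα; exact zero_ne_one hα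
  have hv : v ≠ 0 := fun h => hvw (by rw [h, TensorProduct.zero_tmul])
  have hw : w ≠ 0 := fun h => hvw (by rw [h, TensorProduct.tmul_zero])
  obtain ⟨β, hβ⟩ := exists_dual_eq_one hv
  obtain ⟨β', hβ'⟩ := exists_dual_eq_one hw
  have h1 : (TensorProduct.dualDistribEquiv ℝ L I).symm (eC'.dualMap α) = β ⊗ₜ[ℝ] β' := by
    rw [LinearEquiv.symm_apply_eq]
    refine line_dual_ext (eC'.finrank_eq.trans hC') (x := v ⊗ₜ[ℝ] w) hα ?_
    change β v * β' w = 1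
    rw [hβ, hβ', mul_one]
  have h2 : eC.symm.dualMap (TensorProduct.dualDistribEquiv ℝ I C'' (β' ⊗ₜ[ℝ] γ)) = ω := by
    refine line_dual_ext hC (x := eC (w ⊗ₜ y)) ?_ hω
    rw [LinearEquiv.dualMap_apply, LinearEquiv.symm_apply_apply]
    change β' w * γ y = 1
    rw [hβ', hγ, mul_one]
  simp only [lineTriple, LinearEquiv.trans_apply, TensorProduct.tensorTensorTensorComm_tmul,
    TensorProduct.congr_tmul, LinearEquiv.refl_apply, LinearEquiv.symm_apply_apply,
    TensorProduct.assoc_symm_tmul, h1, TensorProduct.assoc_tmul, h2, contractMiddle_tmul, hβ,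
    one_smul]

end Lines

section Duality

variable {X Y Z : Type*} [NormedAddCommGroup X] [NormedSpace ℝ X] [NormedAddCommGroup Y]
  [NormedSpace ℝ Y] [NormedAddCommGroup Z] [NormedSpace ℝ Z]

/-- The kernel `κ(D)`. -/
abbrev Ker (D : X →L[ℝ] Y) : Submodule ℝ X := LinearMap.ker (D : X →ₗ[ℝ] Y)

/-- The image of `D`. -/
abbrev Im (D : X →L[ℝ] Y) : Submodule ℝ Y := LinearMap.range (D : X →ₗ[ℝ] Y)

/-- The cokernel `𝔠(D) = Y / Im D`. -/
abbrev Coker (D : X →L[ℝ] Y) : Type _ := Y ⧸ Im D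

/-- For Banach spaces, a bounded operator is Fredholm if and only if its image is closed and its
kernel and cokernel are finite-dimensional. -/
theorem isFredholm_iff [CompleteSpace X] [CompleteSpace Y] (D : X →L[ℝ] Y) :
    D.IsFredholm ↔ IsClosed (Im D : Set Y) ∧ FiniteDimensional ℝ (Ker D) ∧
      FiniteDimensional ℝ (Coker D) := by
  refine ⟨fun h => ⟨h.isClosed_range, h.finite_ker, h.finite_coker⟩, fun ⟨h1, h2, h3⟩ => ?_⟩
  refine ⟨?_, h1, h2, h3, Submodule.ClosedComplemented.of_finiteDimensional (Ker D)⟩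
  have : CompleteSpace (Im D) := h1.completeSpace_coe
  let D' : X →L[ℝ] Im D := D.codRestrict (Im D) fun x => ⟨x, rfl⟩
  have hD' : Function.Surjective D' := by
    rintro ⟨_, x, rfl⟩
    exact ⟨x, rfl⟩
  have h4 : Topology.IsStrictMap D' := (D'.isOpenMap hD').isStrictMap D'.continuous
  exact (Topology.IsEmbedding.subtypeVal.isStrictMap_iff (f := D')).1 h4

/-- The index of `D`. -/
def index (D : X →L[ℝ] Y) : ℤ := (finrank ℝ (Ker D) : ℤ) - finrank ℝ (Coker D)

/-- The dual operator `D* : Y* → X*`, `D* β = β ∘ D`. -/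
def dualOp (D : X →L[ℝ] Y) : StrongDual ℝ Y →L[ℝ] StrongDual ℝ X :=
  ContinuousLinearMap.precomp ℝ D

@[simp]
theorem dualOp_apply (D : X →L[ℝ] Y) (β : StrongDual ℝ Y) (x : X) : dualOp D β x = β (D x) := rfl

theorem dualOp_comp (E : Y →L[ℝ] Z) (D : X →L[ℝ] Y) :
    dualOp (E ∘L D) = dualOp D ∘L dualOp E := rfl

/-- A bounded functional that vanishes on the kernel of an operator with closed range factors
through the operator. -/
theorem exists_dualOp_eq [CompleteSpace X] [CompleteSpace Y] (D : X →L[ℝ] Y)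
    (hD : IsClosed (Im D : Set Y)) (α : StrongDual ℝ X) (hα : ∀ x, D x = 0 → α x = 0) :
    ∃ β : StrongDual ℝ Y, dualOp D β = α := by
  have : CompleteSpace (Im D) := hD.completeSpace_coe
  let D' : X →L[ℝ] Im D := D.codRestrict (Im D) fun x => ⟨x, rfl⟩
  have hD' : Function.Surjective D' := by
    rintro ⟨_, x, rfl⟩
    exact ⟨x, rfl⟩
  obtain ⟨C, hC, h⟩ := D'.exists_preimage_norm_le hD'
  choose s hs hsn using h
  have hwd : ∀ x y, D x = D y → α x = α y := fun x y hxy => by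
    have := hα (x - y) (by rw [map_sub, hxy, sub_self])
    rwa [map_sub, sub_eq_zero] at this
  have hDs : ∀ y : Im D, D (s y) = y := fun y => congrArg Subtype.val (hs y)
  let β₀ : Im D →ₗ[ℝ] ℝ :=
    { toFun := fun y => α (s y)
      map_add' := fun y z => by
        rw [← map_add]; apply hwd; rw [map_add, hDs, hDs, hDs]; rfl
      map_smul' := fun c y => by
        rw [RingHom.id_apply, ← map_smul]; apply hwd; rw [map_smul, hDs, hDs]; rfl }
  let β₁ : StrongDual ℝ (Im D) := β₀.mkContinuous (‖α‖ * C) fun y => by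
    calc ‖α (s y)‖ ≤ ‖α‖ * ‖s y‖ := α.le_opNorm _
      _ ≤ ‖α‖ * (C * ‖y‖) := by gcongr; exact hsn y
      _ = ‖α‖ * C * ‖y‖ := by ring
  obtain ⟨β, hβ, -⟩ := exists_extension_norm_eq (Im D) β₁
  refine ⟨β, ?_⟩
  ext x
  have h1 := hβ ⟨D x, x, rfl⟩
  rw [dualOp_apply]
  refine h1.trans ?_
  exact hwd _ _ (hDs _)

theorem finite_range_dualOp (T : X →L[ℝ] Y) (hT : FiniteDimensional ℝ (Im T)) :
    FiniteDimensional ℝ (Im (dualOp T)) := by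
  let T' : X →L[ℝ] Im T := T.codRestrict (Im T) fun x => ⟨x, rfl⟩
  have hle : Im (dualOp T) ≤ LinearMap.range (dualOp T' : StrongDual ℝ (Im T) →ₗ[ℝ] _) := by
    rintro _ ⟨β, rfl⟩
    exact ⟨β ∘L (Im T).subtypeL, rfl⟩
  have : FiniteDimensional ℝ (StrongDual ℝ (Im T)) :=
    Module.Finite.of_injective (ContinuousLinearMap.coeLM ℝ : StrongDual ℝ (Im T) →ₗ[ℝ] _)
      ContinuousLinearMap.coe_injective
  exact Submodule.finiteDimensional_of_le hle

/-- The dual of a Fredholm operator is Fredholm. -/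
theorem isFredholm_dualOp {D : X →L[ℝ] Y} (hD : D.IsFredholm) : (dualOp D).IsFredholm := by
  obtain ⟨E, h1, h2⟩ := hD.exists_isQuasiInverse
  refine ContinuousLinearMap.IsFredholm.of_isQuasiInverse (v := dualOp E) ⟨?_, ?_⟩
  · have h := LinearMap.FiniteRangeSetoid.equiv_iff_hasFiniteRange.1 h2
    have h' := finite_range_dualOp (D ∘L E - ContinuousLinearMap.id ℝ Y)
      (Module.Finite.iff_fg.2 h)
    have heq : ((dualOp E : StrongDual ℝ X →ₗ[ℝ] StrongDual ℝ Y) ∘ₗ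
        (dualOp D : StrongDual ℝ Y →ₗ[ℝ] StrongDual ℝ X) - LinearMap.id) =
        (dualOp (D ∘L E - ContinuousLinearMap.id ℝ Y) : StrongDual ℝ Y →ₗ[ℝ] _) := by
      ext β y
      exact (map_sub β _ _).symm
    refine LinearMap.FiniteRangeSetoid.equiv_iff_hasFiniteRange.2 ?_
    rw [heq]
    exact Module.Finite.iff_fg.1 h'
  · have h := LinearMap.FiniteRangeSetoid.equiv_iff_hasFiniteRange.1 h1
    have h' := finite_range_dualOp (E ∘L D - ContinuousLinearMap.id ℝ X)
      (Module.Finite.iff_fg.2 h)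
    have heq : ((dualOp D : StrongDual ℝ Y →ₗ[ℝ] StrongDual ℝ X) ∘ₗ
        (dualOp E : StrongDual ℝ X →ₗ[ℝ] StrongDual ℝ Y) - LinearMap.id) =
        (dualOp (E ∘L D - ContinuousLinearMap.id ℝ X) : StrongDual ℝ X →ₗ[ℝ] _) := by
      ext α x
      exact (map_sub α _ _).symm
    refine LinearMap.FiniteRangeSetoid.equiv_iff_hasFiniteRange.2 ?_
    rw [heq]
    exact Module.Finite.iff_fg.1 h'

theorem dualOp_injective {D : X →L[ℝ] Y} (hD : Function.Surjective D) :
    Function.Injective (dualOp D) := fun β γ h =>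
  ContinuousLinearMap.ext fun y => by
    obtain ⟨x, rfl⟩ := hD y
    exact DFunLike.congr_fun h x

theorem dualOp_surjective [CompleteSpace X] [CompleteSpace Y] {D : X →L[ℝ] Y} {E : Y →L[ℝ] Z}
    (hD : Function.Injective D) (hDE : Function.Exact D E) :
    Function.Surjective (dualOp D) := fun α => by
  refine exists_dualOp_eq D ?_ α fun x hx => ?_
  · have : (Im D : Set Y) = E ⁻¹' {0} := Set.ext fun y => (hDE y).symm
    rw [this]
    exact isClosed_singleton.preimage E.continuous
  · rw [hD (hx.trans (map_zero D).symm), map_zero]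

theorem exact_dualOp [CompleteSpace Y] [CompleteSpace Z] {D : X →L[ℝ] Y} {E : Y →L[ℝ] Z}
    (hDE : Function.Exact D E) (hE : Function.Surjective E) :
    Function.Exact (dualOp E) (dualOp D) := fun β => by
  constructor
  · intro h
    refine exists_dualOp_eq E ?_ β fun y hy => ?_
    · have : (Im E : Set Z) = Set.univ := Set.eq_univ_of_forall hE
      rw [this]
      exact isClosed_univ
    · obtain ⟨x, rfl⟩ := (hDE y).1 hy
      exact DFunLike.congr_fun h x
  · rintro ⟨γ, rfl⟩
    refine ContinuousLinearMap.ext fun x => ?_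
    rw [dualOp_apply, dualOp_apply, hDE.apply_apply_eq_zero, map_zero]
    rfl

/-- The map `𝒟_D : κ(D) → 𝔠(D*)*`, `𝒟_D(x)(α + Im D*) = α(x)`. -/
def kerDualMap (D : X →L[ℝ] Y) : Ker D →ₗ[ℝ] Dual ℝ (Coker (dualOp D)) where
  toFun x := (Im (dualOp D)).liftQ
    (LinearMap.applyₗ (x : X) ∘ₗ (ContinuousLinearMap.coeLM ℝ : StrongDual ℝ X →ₗ[ℝ] _)) (by
      rintro _ ⟨β, rfl⟩
      have hx : D (x : X) = 0 := x.2
      change β (D (x : X)) = 0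
      rw [hx, map_zero])
  map_add' x y := by
    refine LinearMap.ext fun a => ?_
    obtain ⟨α, rfl⟩ := Submodule.mkQ_surjective _ a
    exact map_add α _ _
  map_smul' c x := by
    refine LinearMap.ext fun a => ?_
    obtain ⟨α, rfl⟩ := Submodule.mkQ_surjective _ a
    exact map_smul α c _

@[simp]
theorem kerDualMap_apply (D : X →L[ℝ] Y) (x : Ker D) (α : StrongDual ℝ X) :
    kerDualMap D x ((Im (dualOp D)).mkQ α) = α x := rfl

theorem kerDualMap_bijective [CompleteSpace X] [CompleteSpace Y] {D : X →L[ℝ] Y}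
    (hD : D.IsFredholm) : Function.Bijective (kerDualMap D) := by
  have hfin : FiniteDimensional ℝ (Ker D) := hD.finite_ker
  have hinj : Function.Injective (kerDualMap D) := by
    refine (injective_iff_map_eq_zero _).2 fun x hx => ?_
    by_contra hne
    have hne' : (x : X) ≠ 0 := fun h => hne (Subtype.ext h)
    obtain ⟨α, -, hα⟩ := exists_dual_vector ℝ (x : X) (norm_ne_zero_iff.2 hne')
    have h0 : α (x : X) = 0 := LinearMap.congr_fun hx ((Im (dualOp D)).mkQ α)
    rw [h0] at hα
    exact norm_ne_zero_iff.2 hne' (by exact_mod_cast hα.symm)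
  let r : Coker (dualOp D) →ₗ[ℝ] Dual ℝ (Ker D) := (kerDualMap D).flip
  have hr : Function.Injective r := by
    refine (injective_iff_map_eq_zero _).2 fun a ha => ?_
    obtain ⟨α, rfl⟩ := Submodule.mkQ_surjective _ a
    obtain ⟨β, hβ⟩ := exists_dualOp_eq D hD.isClosed_range α fun x hx =>
      LinearMap.congr_fun ha ⟨x, hx⟩
    exact (Submodule.Quotient.mk_eq_zero _).2 ⟨β, hβ⟩
  have : FiniteDimensional ℝ (Coker (dualOp D)) := FiniteDimensional.of_injective r hr
  have h1 := LinearMap.finrank_le_finrank_of_injective hr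
  have h2 := LinearMap.finrank_le_finrank_of_injective hinj
  rw [Subspace.dual_finrank_eq] at h1 h2
  refine ⟨hinj, (LinearMap.injective_iff_surjective_of_finrank_eq_finrank ?_).1 hinj⟩
  rw [Subspace.dual_finrank_eq]
  exact le_antisymm h2 h1

/-- The isomorphism `𝒟_D : κ(D) → 𝔠(D*)*`, `𝒟_D(x)(α + Im D*) = α(x)`. -/
def kerDualEquiv [CompleteSpace X] [CompleteSpace Y] {D : X →L[ℝ] Y}
    (hD : D.IsFredholm) : Ker D ≃ₗ[ℝ] Dual ℝ (Coker (dualOp D)) :=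
  LinearEquiv.ofBijective (kerDualMap D) (kerDualMap_bijective hD)

theorem continuous_comp_mkQ {D : X →L[ℝ] Y} (hD : D.IsFredholm) (β : Dual ℝ (Coker D)) :
    Continuous (β ∘ₗ (Im D).mkQ) := by
  have hcl : IsClosed (Im D : Set Y) := hD.isClosed_range
  have : FiniteDimensional ℝ (Coker D) := hD.finite_coker
  have hβ : Continuous β := LinearMap.continuous_of_finiteDimensional β
  exact hβ.comp (Im D).mkQL.continuous

/-- The map `𝒟_D : 𝔠(D)* → κ(D*)`, `𝒟_D(β)(y) = β(y + Im D)`. -/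
def cokerDualMap {D : X →L[ℝ] Y} (hD : D.IsFredholm) :
    Dual ℝ (Coker D) →ₗ[ℝ] Ker (dualOp D) where
  toFun β := ⟨⟨β ∘ₗ (Im D).mkQ, continuous_comp_mkQ hD β⟩, by
    refine ContinuousLinearMap.ext fun x => ?_
    have h0 : (Im D).mkQ (D x) = 0 := (Submodule.Quotient.mk_eq_zero _).2 ⟨x, rfl⟩
    change β ((Im D).mkQ (D x)) = 0
    rw [h0, map_zero]⟩
  map_add' _ _ := rfl
  map_smul' _ _ := rfl

@[simp]
theorem cokerDualMap_apply {D : X →L[ℝ] Y} (hD : D.IsFredholm) (β : Dual ℝ (Coker D)) (y : Y) :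
    (cokerDualMap hD β : StrongDual ℝ Y) y = β ((Im D).mkQ y) := rfl

theorem cokerDualMap_bijective {D : X →L[ℝ] Y} (hD : D.IsFredholm) :
    Function.Bijective (cokerDualMap hD) := by
  constructor
  · refine (injective_iff_map_eq_zero _).2 fun β hβ => LinearMap.ext fun a => ?_
    obtain ⟨y, rfl⟩ := Submodule.mkQ_surjective _ a
    exact DFunLike.congr_fun (congrArg Subtype.val hβ) y
  · rintro ⟨γ, hγ⟩
    refine ⟨(Im D).liftQ (γ : Y →ₗ[ℝ] ℝ) ?_, ?_⟩
    · rintro _ ⟨x, rfl⟩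
      exact DFunLike.congr_fun hγ x
    · exact Subtype.ext (ContinuousLinearMap.ext fun y => rfl)

/-- The isomorphism `𝒟_D : 𝔠(D)* → κ(D*)`, `𝒟_D(β)(y) = β(y + Im D)`. -/
def cokerDualEquiv {D : X →L[ℝ] Y} (hD : D.IsFredholm) :
    Dual ℝ (Coker D) ≃ₗ[ℝ] Ker (dualOp D) :=
  LinearEquiv.ofBijective (cokerDualMap hD) (cokerDualMap_bijective hD)

/-- The determinant line `λ(D) = λ(κ(D)) ⊗ λ(𝔠(D))*`. -/
abbrev DetLine (D : X →L[ℝ] Y) : Type _ := TopExt (Ker D) ⊗[ℝ] Dual ℝ (TopExt (Coker D))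

/-- The isomorphism `λ(D) → λ(D*)`,
`x ⊗ α ↦ (-1)^(ind D · dim 𝔠(D)) λ(𝒟_D)(𝒫⁻¹ α) ⊗ 𝒫(λ(𝒟_D) x)`. -/
def dualization [CompleteSpace X] [CompleteSpace Y] {D : X →L[ℝ] Y} (hD : D.IsFredholm) :
    DetLine D ≃ₗ[ℝ] DetLine (dualOp D) :=
  haveI : FiniteDimensional ℝ (Coker D) := hD.finite_coker
  haveI : FiniteDimensional ℝ (Coker (dualOp D)) := (isFredholm_dualOp hD).finite_coker
  TensorProduct.comm ℝ (TopExt (Ker D)) (Dual ℝ (TopExt (Coker D))) ≪≫ₗ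
    TensorProduct.congr
      ((pairing (Coker D)).symm ≪≫ₗ topMap (cokerDualEquiv hD))
      (topMap (kerDualEquiv hD) ≪≫ₗ pairing (Coker (dualOp D))) ≪≫ₗ
    signEquiv (DetLine (dualOp D)) (index D * finrank ℝ (Coker D))

theorem dualization_tmul [CompleteSpace X] [CompleteSpace Y] {D : X →L[ℝ] Y} (hD : D.IsFredholm)
    [FiniteDimensional ℝ (Coker D)] [FiniteDimensional ℝ (Coker (dualOp D))]
    (x : TopExt (Ker D)) (α : Dual ℝ (TopExt (Coker D))) :
    dualization hD (x ⊗ₜ α) = ((-1 : ℝ) ^ (index D * finrank ℝ (Coker D))) •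
      (topMap (cokerDualEquiv hD) ((pairing (Coker D)).symm α) ⊗ₜ[ℝ]
        pairing (Coker (dualOp D)) (topMap (kerDualEquiv hD) x)) := rfl

/-- The graded swap `R : λ(D₁) ⊗ λ(D₂) → λ(D₂) ⊗ λ(D₁)`,
`v₁ ⊗ v₂ ↦ (-1)^(ind D₁ · ind D₂) v₂ ⊗ v₁`. -/
def gradedSwap {X₁ Y₁ X₂ Y₂ : Type*} [NormedAddCommGroup X₁] [NormedSpace ℝ X₁]
    [NormedAddCommGroup Y₁] [NormedSpace ℝ Y₁] [NormedAddCommGroup X₂] [NormedSpace ℝ X₂]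
    [NormedAddCommGroup Y₂] [NormedSpace ℝ Y₂] (D₁ : X₁ →L[ℝ] Y₁) (D₂ : X₂ →L[ℝ] Y₂) :
    DetLine D₁ ⊗[ℝ] DetLine D₂ ≃ₗ[ℝ] DetLine D₂ ⊗[ℝ] DetLine D₁ :=
  TensorProduct.comm ℝ (DetLine D₁) (DetLine D₂) ≪≫ₗ
    signEquiv (DetLine D₂ ⊗[ℝ] DetLine D₁) (index D₁ * index D₂)

theorem gradedSwap_tmul {X₁ Y₁ X₂ Y₂ : Type*} [NormedAddCommGroup X₁] [NormedSpace ℝ X₁]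
    [NormedAddCommGroup Y₁] [NormedSpace ℝ Y₁] [NormedAddCommGroup X₂] [NormedSpace ℝ X₂]
    [NormedAddCommGroup Y₂] [NormedSpace ℝ Y₂] (D₁ : X₁ →L[ℝ] Y₁) (D₂ : X₂ →L[ℝ] Y₂)
    (z₁ : DetLine D₁) (z₂ : DetLine D₂) :
    gradedSwap D₁ D₂ (z₁ ⊗ₜ z₂) = ((-1 : ℝ) ^ (index D₁ * index D₂)) • (z₂ ⊗ₜ[ℝ] z₁) := rfl

end Duality

section Triples

/-- An exact triple of Fredholm operators: a commutative diagram of bounded operators with exact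
rows `0 → X' → X → X'' → 0` and `0 → Y' → Y → Y'' → 0` and Fredholm columns `D'`, `D`, `D''`. -/
structure ExactTriple (X Y X' Y' X'' Y'' : Type*)
    [NormedAddCommGroup X] [NormedSpace ℝ X] [NormedAddCommGroup Y] [NormedSpace ℝ Y]
    [NormedAddCommGroup X'] [NormedSpace ℝ X'] [NormedAddCommGroup Y'] [NormedSpace ℝ Y']
    [NormedAddCommGroup X''] [NormedSpace ℝ X''] [NormedAddCommGroup Y'']
    [NormedSpace ℝ Y''] where
  D : X →L[ℝ] Y
  D' : X' →L[ℝ] Y'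
  D'' : X'' →L[ℝ] Y''
  iX : X' →L[ℝ] X
  jX : X →L[ℝ] X''
  iY : Y' →L[ℝ] Y
  jY : Y →L[ℝ] Y''
  fredholm : D.IsFredholm
  fredholm' : D'.IsFredholm
  fredholm'' : D''.IsFredholm
  comm_i : D ∘L iX = iY ∘L D'
  comm_j : D'' ∘L jX = jY ∘L D
  iX_injective : Function.Injective iX
  exact_X : Function.Exact iX jX
  jX_surjective : Function.Surjective jX
  iY_injective : Function.Injective iY
  exact_Y : Function.Exact iY jY
  jY_surjective : Function.Surjective jY

namespace ExactTriple

variable {X Y X' Y' X'' Y'' : Type*}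
  [NormedAddCommGroup X] [NormedSpace ℝ X] [NormedAddCommGroup Y] [NormedSpace ℝ Y]
  [NormedAddCommGroup X'] [NormedSpace ℝ X'] [NormedAddCommGroup Y'] [NormedSpace ℝ Y']
  [NormedAddCommGroup X''] [NormedSpace ℝ X''] [NormedAddCommGroup Y''] [NormedSpace ℝ Y'']
  (t : ExactTriple X Y X' Y' X'' Y'')

theorem comm_i_apply (x : X') : t.D (t.iX x) = t.iY (t.D' x) := DFunLike.congr_fun t.comm_i x

theorem comm_j_apply (x : X) : t.D'' (t.jX x) = t.jY (t.D x) := DFunLike.congr_fun t.comm_j x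

/-- The map `κ(D') → κ(D)` induced by `iX`. -/
def kerI : Ker t.D' →ₗ[ℝ] Ker t.D :=
  (t.iX : X' →ₗ[ℝ] X).restrict fun x (hx : t.D' x = 0) => by
    change t.D (t.iX x) = 0
    rw [t.comm_i_apply, hx, map_zero]

/-- The map `κ(D) → κ(D'')` induced by `jX`. -/
def kerJ : Ker t.D →ₗ[ℝ] Ker t.D'' :=
  (t.jX : X →ₗ[ℝ] X'').restrict fun x (hx : t.D x = 0) => by
    change t.D'' (t.jX x) = 0
    rw [t.comm_j_apply, hx, map_zero]

/-- The map `𝔠(D') → 𝔠(D)` induced by `iY`. -/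
def cokerI : Coker t.D' →ₗ[ℝ] Coker t.D :=
  (Im t.D').mapQ (Im t.D) (t.iY : Y' →ₗ[ℝ] Y) (by
    rintro _ ⟨x, rfl⟩
    exact ⟨t.iX x, t.comm_i_apply x⟩)

/-- The map `𝔠(D) → 𝔠(D'')` induced by `jY`. -/
def cokerJ : Coker t.D →ₗ[ℝ] Coker t.D'' :=
  (Im t.D).mapQ (Im t.D'') (t.jY : Y →ₗ[ℝ] Y'') (by
    rintro _ ⟨x, rfl⟩
    exact ⟨t.jX x, t.comm_j_apply x⟩)

/-- The connecting homomorphism `δ : κ(D'') → 𝔠(D')` of the snake lemma. -/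
def connecting : Ker t.D'' →ₗ[ℝ] Coker t.D' :=
  SnakeLemma.δ' (t.D' : X' →ₗ[ℝ] Y') (t.D : X →ₗ[ℝ] Y) (t.D'' : X'' →ₗ[ℝ] Y'')
    (t.iX : X' →ₗ[ℝ] X) (t.jX : X →ₗ[ℝ] X'') t.exact_X
    (t.iY : Y' →ₗ[ℝ] Y) (t.jY : Y →ₗ[ℝ] Y'') t.exact_Y
    (LinearMap.ext fun x => (t.comm_i_apply x).symm)
    (LinearMap.ext fun x => (t.comm_j_apply x).symm)
    (Ker t.D'').subtype (LinearMap.exact_subtype_ker_map _)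
    (Im t.D').mkQ (LinearMap.exact_map_mkQ_range _)
    t.jX_surjective t.iY_injective

/-- `δ(x'') = y' + Im D'` whenever `jX x = x''` and `iY y' = D x`. -/
theorem connecting_apply (x'' : Ker t.D'') (x : X) (hx : t.jX x = x'') (y' : Y')
    (hy' : t.iY y' = t.D x) : t.connecting x'' = (Im t.D').mkQ y' :=
  SnakeLemma.δ'_eq (t.D' : X' →ₗ[ℝ] Y') (t.D : X →ₗ[ℝ] Y) (t.D'' : X'' →ₗ[ℝ] Y'')
    (t.iX : X' →ₗ[ℝ] X) (t.jX : X →ₗ[ℝ] X'') t.exact_X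
    (t.iY : Y' →ₗ[ℝ] Y) (t.jY : Y →ₗ[ℝ] Y'') t.exact_Y
    (LinearMap.ext fun x => (t.comm_i_apply x).symm)
    (LinearMap.ext fun x => (t.comm_j_apply x).symm)
    (Ker t.D'').subtype (LinearMap.exact_subtype_ker_map _)
    (Im t.D').mkQ (LinearMap.exact_map_mkQ_range _)
    t.jX_surjective t.iY_injective x'' x hx y' hy'

theorem kerI_injective : Function.Injective t.kerI := fun _ _ h =>
  Subtype.ext (t.iX_injective (congrArg Subtype.val h))

theorem exact_kerI_kerJ : Function.Exact t.kerI t.kerJ := by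
  rintro ⟨x, hx⟩
  constructor
  · intro h
    obtain ⟨x', rfl⟩ := (t.exact_X x).1 (congrArg Subtype.val h)
    refine ⟨⟨x', ?_⟩, rfl⟩
    apply t.iY_injective
    change t.iY (t.D' x') = t.iY 0
    rw [← t.comm_i_apply, map_zero]
    exact hx
  · rintro ⟨x', hx'⟩
    apply Subtype.ext
    change t.jX x = 0
    have : t.iX x' = x := congrArg Subtype.val hx'
    rw [← this, t.exact_X.apply_apply_eq_zero]

theorem exact_kerJ_connecting : Function.Exact t.kerJ t.connecting :=
  SnakeLemma.exact_δ'_right (t.D' : X' →ₗ[ℝ] Y') (t.D : X →ₗ[ℝ] Y) (t.D'' : X'' →ₗ[ℝ] Y'')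
    (t.iX : X' →ₗ[ℝ] X) (t.jX : X →ₗ[ℝ] X'') t.exact_X
    (t.iY : Y' →ₗ[ℝ] Y) (t.jY : Y →ₗ[ℝ] Y'') t.exact_Y
    (LinearMap.ext fun x => (t.comm_i_apply x).symm)
    (LinearMap.ext fun x => (t.comm_j_apply x).symm)
    (Ker t.D).subtype (LinearMap.exact_subtype_ker_map _)
    (Ker t.D'').subtype (LinearMap.exact_subtype_ker_map _)
    (Im t.D').mkQ (LinearMap.exact_map_mkQ_range _)
    t.jX_surjective t.iY_injective t.kerJ rfl Subtype.val_injective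

theorem exact_connecting_cokerI : Function.Exact t.connecting t.cokerI :=
  SnakeLemma.exact_δ'_left (t.D' : X' →ₗ[ℝ] Y') (t.D : X →ₗ[ℝ] Y) (t.D'' : X'' →ₗ[ℝ] Y'')
    (t.iX : X' →ₗ[ℝ] X) (t.jX : X →ₗ[ℝ] X'') t.exact_X
    (t.iY : Y' →ₗ[ℝ] Y) (t.jY : Y →ₗ[ℝ] Y'') t.exact_Y
    (LinearMap.ext fun x => (t.comm_i_apply x).symm)
    (LinearMap.ext fun x => (t.comm_j_apply x).symm)
    (Ker t.D'').subtype (LinearMap.exact_subtype_ker_map _)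
    (Im t.D').mkQ (LinearMap.exact_map_mkQ_range _)
    (Im t.D).mkQ (LinearMap.exact_map_mkQ_range _)
    t.jX_surjective t.iY_injective t.cokerI rfl (Submodule.mkQ_surjective _)

theorem exact_cokerI_cokerJ : Function.Exact t.cokerI t.cokerJ := by
  intro a
  obtain ⟨y, rfl⟩ := Submodule.mkQ_surjective _ a
  constructor
  · intro h
    obtain ⟨x'', hx''⟩ := (Submodule.Quotient.mk_eq_zero _).1 h
    obtain ⟨x, rfl⟩ := t.jX_surjective x''
    have h0 : t.jY (y - t.D x) = 0 := by
      rw [map_sub, ← t.comm_j_apply, sub_eq_zero]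
      exact hx''.symm
    obtain ⟨y', hy'⟩ := (t.exact_Y _).1 h0
    refine ⟨(Im t.D').mkQ y', ?_⟩
    change (Im t.D).mkQ (t.iY y') = _
    rw [hy', map_sub, sub_eq_self]
    exact (Submodule.Quotient.mk_eq_zero _).2 ⟨x, rfl⟩
  · rintro ⟨b, hb⟩
    obtain ⟨y', rfl⟩ := Submodule.mkQ_surjective _ b
    rw [← hb]
    change (Im t.D'').mkQ (t.jY (t.iY y')) = 0
    rw [t.exact_Y.apply_apply_eq_zero, map_zero]

theorem cokerJ_surjective : Function.Surjective t.cokerJ := by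
  intro a
  obtain ⟨y'', rfl⟩ := Submodule.mkQ_surjective _ a
  obtain ⟨y, rfl⟩ := t.jY_surjective y''
  exact ⟨(Im t.D).mkQ y, rfl⟩

instance : FiniteDimensional ℝ (Ker t.D) := t.fredholm.finite_ker
instance : FiniteDimensional ℝ (Ker t.D'') := t.fredholm''.finite_ker
instance : FiniteDimensional ℝ (Coker t.D) := t.fredholm.finite_coker
instance : FiniteDimensional ℝ (Coker t.D') := t.fredholm'.finite_coker
instance : FiniteDimensional ℝ (Coker t.D'') := t.fredholm''.finite_coker

/-- `∧ : λ(κ(D')) ⊗ λ(Im jX) → λ(κ(D))`. -/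
def wedgeKer : TopExt (Ker t.D') ⊗[ℝ] TopExt (LinearMap.range t.kerJ) ≃ₗ[ℝ] TopExt (Ker t.D) :=
  wedge (f := t.kerI) (g := t.kerJ.rangeRestrict) t.kerI_injective
    (fun x => by rw [← t.exact_kerI_kerJ x]; exact Subtype.ext_iff)
    t.kerJ.surjective_rangeRestrict

/-- `∧ : λ(Im jX) ⊗ λ(Im δ) → λ(κ(D''))`. -/
def wedgeKer'' : TopExt (LinearMap.range t.kerJ) ⊗[ℝ] TopExt (LinearMap.range t.connecting)
    ≃ₗ[ℝ] TopExt (Ker t.D'') :=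
  wedge (f := (LinearMap.range t.kerJ).subtype) (g := t.connecting.rangeRestrict)
    Subtype.val_injective
    (fun x => by
      refine Subtype.ext_iff.trans ((t.exact_kerJ_connecting x).trans ?_)
      simp)
    t.connecting.surjective_rangeRestrict

/-- `∧ : λ(Im δ) ⊗ λ(Im iY) → λ(𝔠(D'))`. -/
def wedgeCoker' : TopExt (LinearMap.range t.connecting) ⊗[ℝ] TopExt (LinearMap.range t.cokerI)
    ≃ₗ[ℝ] TopExt (Coker t.D') :=
  wedge (f := (LinearMap.range t.connecting).subtype) (g := t.cokerI.rangeRestrict)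
    Subtype.val_injective
    (fun x => by
      refine Subtype.ext_iff.trans ((t.exact_connecting_cokerI x).trans ?_)
      simp)
    t.cokerI.surjective_rangeRestrict

/-- `∧ : λ(Im iY) ⊗ λ(𝔠(D'')) → λ(𝔠(D))`. -/
def wedgeCoker : TopExt (LinearMap.range t.cokerI) ⊗[ℝ] TopExt (Coker t.D'')
    ≃ₗ[ℝ] TopExt (Coker t.D) :=
  wedge (f := (LinearMap.range t.cokerI).subtype) (g := t.cokerJ)
    Subtype.val_injective
    (fun x => by
      refine (t.exact_cokerI_cokerJ x).trans ?_
      simp)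
    t.cokerJ_surjective

/-- The sign exponent `ε_t = (ind D'') dim 𝔠(D') + dim 𝔠(D) · dim Im δ`. -/
def signExp : ℤ :=
  index t.D'' * finrank ℝ (Coker t.D') +
    finrank ℝ (Coker t.D) * finrank ℝ (LinearMap.range t.connecting)

/-- The isomorphism `Ψ_t : λ(D') ⊗ λ(D'') → λ(D)`, put together from the four isomorphisms `∧`,
the evaluation `λ(Im δ) ⊗ λ(Im δ)* ≅ ℝ` and the sign `(-1)^ε_t`; see `Psi_apply` for its value. -/
def Psi : DetLine t.D' ⊗[ℝ] DetLine t.D'' ≃ₗ[ℝ] DetLine t.D :=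
  lineTriple (finrank_topExt _) t.wedgeKer t.wedgeKer'' t.wedgeCoker' t.wedgeCoker ≪≫ₗ
    signEquiv (DetLine t.D) t.signExp

/-- `Ψ_t(x ⊗ (v ∧ w)* ⊗ (u ∧ v) ⊗ y*) = (-1)^ε_t (x ∧ u) ⊗ (w ∧ y)*`, where `ℓ*` denotes the
functional on a line that takes the value `1` at `ℓ`. -/
theorem Psi_apply (x : TopExt (Ker t.D')) (u : TopExt (LinearMap.range t.kerJ))
    (v : TopExt (LinearMap.range t.connecting)) (w : TopExt (LinearMap.range t.cokerI))
    (y : TopExt (Coker t.D'')) (α : Dual ℝ (TopExt (Coker t.D')))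
    (γ : Dual ℝ (TopExt (Coker t.D''))) (ω : Dual ℝ (TopExt (Coker t.D)))
    (hα : α (t.wedgeCoker' (v ⊗ₜ w)) = 1) (hγ : γ y = 1) (hω : ω (t.wedgeCoker (w ⊗ₜ y)) = 1) :
    t.Psi ((x ⊗ₜ α) ⊗ₜ (t.wedgeKer'' (u ⊗ₜ v) ⊗ₜ γ)) =
      ((-1 : ℝ) ^ t.signExp) • (t.wedgeKer (x ⊗ₜ u) ⊗ₜ[ℝ] ω) := by
  rw [Psi, LinearEquiv.trans_apply, signEquiv_apply,
    lineTriple_apply (finrank_topExt _) (finrank_topExt _) (finrank_topExt _) t.wedgeKer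
      t.wedgeKer'' t.wedgeCoker' t.wedgeCoker x u v w y α γ ω hα hγ hω]

/-- The dual triple `t*`. -/
def dual [CompleteSpace X] [CompleteSpace Y] [CompleteSpace X'] [CompleteSpace Y']
    [CompleteSpace X''] [CompleteSpace Y''] :
    ExactTriple (StrongDual ℝ Y) (StrongDual ℝ X) (StrongDual ℝ Y'') (StrongDual ℝ X'')
      (StrongDual ℝ Y') (StrongDual ℝ X') where
  D := dualOp t.D
  D' := dualOp t.D''
  D'' := dualOp t.D'
  iX := dualOp t.jY
  jX := dualOp t.iY
  iY := dualOp t.jX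
  jY := dualOp t.iX
  fredholm := isFredholm_dualOp t.fredholm
  fredholm' := isFredholm_dualOp t.fredholm''
  fredholm'' := isFredholm_dualOp t.fredholm'
  comm_i := by rw [← dualOp_comp, ← dualOp_comp, t.comm_j]
  comm_j := by rw [← dualOp_comp, ← dualOp_comp, t.comm_i]
  iX_injective := dualOp_injective t.jY_surjective
  exact_X := exact_dualOp t.exact_Y t.jY_surjective
  jX_surjective := dualOp_surjective t.iY_injective t.exact_Y
  iY_injective := dualOp_injective t.jX_surjective
  exact_Y := exact_dualOp t.exact_X t.jX_surjective
  jY_surjective := dualOp_surjective t.iX_injective t.exact_X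

end ExactTriple

end Triples

end FredholmDet

end

noncomputable section

namespace FredholmDet

/-! Both sides are linear maps out of a tensor product of four lines, so they agree as soon as they
agree on one generator. A generator is written down with bases adapted to the snake sequence. Let
`a, b, c, d, e` be the dimensions of `κ(D')`, `Im jX`, `Im δ`, `Im iY` and `𝔠(D'')`. By exactness
the six terms have dimensions `a, a + b, b + c, c + d, d + e, e`, and their bases can be chosen so
that each map kills the first block and carries the second block to the first block of the next
basis (`exists_adaptedBases`). On the corresponding generators the four isomorphisms `∧` only
concatenate blocks, so `Ψ_t` is the sign `(-1)^ε_t` (`Psi_basisWedge`), and dualization passes to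
dual bases with the sign from its definition and the two signs of `𝒫` (`dualization_basisWedge`).

The geometric input is that, under the pairings `𝒟`, the snake sequence of `t*` is the transpose of
the snake sequence of `t`. In particular the two connecting maps are transposes of each other
without any sign (`kerDualMap_dual_connecting`). Hence the dual bases are adapted to `t*`, with the
dimensions in the order `e, d, c, b, a`, once the two blocks are exchanged in each of the four
two-block bases (`AdaptedBases.dual`). Exchanging blocks of sizes `p` and `q` multiplies a generator
by `(-1)^(pq)`, which contributes the exponents `de`, `cd`, `bc` and `ab` (`Psi_dual_basisWedge`).

Both composites therefore send the chosen generator to a sign times the same element, and the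
proposition becomes a parity identity in five natural numbers (`dual_signs_eq`). -/

theorem neg_one_pow_mul_self (n : ℕ) : ((-1 : ℝ) ^ n) * (-1 : ℝ) ^ n = 1 := by
  rw [← mul_pow]; norm_num

/-! ### Generators of top exterior powers given by bases -/

section BasisWedges

variable {V V' V'' W : Type*}
  [AddCommGroup V] [Module ℝ V] [AddCommGroup V'] [Module ℝ V']
  [AddCommGroup V''] [Module ℝ V''] [AddCommGroup W] [Module ℝ W]

theorem basis_card_eq {n : ℕ} (b : Basis (Fin n) ℝ V) : n = finrank ℝ V := by
  rw [finrank_eq_card_basis b, Fintype.card_fin]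

/-- The generator `b₁ ∧ … ∧ bₙ` of `λ(V)` given by a basis `b` of `V`. -/
def basisWedge {n : ℕ} (b : Basis (Fin n) ℝ V) : TopExt V := topWedge (basis_card_eq b) b

theorem basisWedge_ne_zero {n : ℕ} (b : Basis (Fin n) ℝ V) : basisWedge b ≠ 0 :=
  topWedge_basis_ne_zero b _

theorem topMap_basisWedge (e : V ≃ₗ[ℝ] W) {n : ℕ} (b : Basis (Fin n) ℝ V) :
    topMap e (basisWedge b) = basisWedge (b.map e) :=
  topMap_topWedge e _ _

/-- Vectors anticommute in the exterior algebra, so each factor that `v` passes costs one sign. -/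
theorem ι_mul_prod_map_ι (v : V) (l : List V) :
    ExteriorAlgebra.ι ℝ v * (l.map (ExteriorAlgebra.ι ℝ)).prod =
      ((-1 : ℝ) ^ l.length) • ((l.map (ExteriorAlgebra.ι ℝ)).prod * ExteriorAlgebra.ι ℝ v) := by
  induction l with
  | nil => simp
  | cons w l ih =>
    have h : ExteriorAlgebra.ι ℝ v * ExteriorAlgebra.ι ℝ w =
        -(ExteriorAlgebra.ι ℝ w * ExteriorAlgebra.ι ℝ v) :=
      eq_neg_of_add_eq_zero_left (ExteriorAlgebra.ι_add_mul_swap v w)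
    rw [List.map_cons, List.prod_cons, ← mul_assoc, h, neg_mul, mul_assoc, ih, List.length_cons,
      pow_succ, mul_neg_one, neg_smul, mul_smul_comm, mul_assoc]

/-- Graded commutativity of the exterior algebra on products of vectors. -/
theorem prod_map_ι_mul_prod_map_ι (k l : List V) :
    (k.map (ExteriorAlgebra.ι ℝ)).prod * (l.map (ExteriorAlgebra.ι ℝ)).prod =
      ((-1 : ℝ) ^ (k.length * l.length)) •
        ((l.map (ExteriorAlgebra.ι ℝ)).prod * (k.map (ExteriorAlgebra.ι ℝ)).prod) := by
  induction k with
  | nil => simp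
  | cons v k ih =>
    rw [List.map_cons, List.prod_cons, mul_assoc, ih, mul_smul_comm, ← mul_assoc,
      ι_mul_prod_map_ι, smul_mul_assoc, smul_smul, mul_assoc, List.length_cons, ← pow_add]
    congr 2
    ring

theorem topWedge_append_swap {m n : ℕ} (h : m + n = finrank ℝ V) (h' : n + m = finrank ℝ V)
    (x : Fin m → V) (y : Fin n → V) :
    topWedge h' (Fin.append y x) = ((-1 : ℝ) ^ (m * n)) • topWedge h (Fin.append x y) := by
  have key : ∀ {p q : ℕ} (u : Fin p → V) (w : Fin q → V),
      ExteriorAlgebra.ιMulti ℝ (p + q) (Fin.append u w) =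
        ((List.ofFn u).map (ExteriorAlgebra.ι ℝ)).prod *
          ((List.ofFn w).map (ExteriorAlgebra.ι ℝ)).prod := by
    intro p q u w
    rw [ExteriorAlgebra.ιMulti_apply, ← List.prod_append, ← List.map_append,
      ← List.ofFn_fin_append, List.map_ofFn]
    rfl
  -- In the exterior algebra itself the degrees `m + n` and `n + m` need no cast.
  apply Subtype.ext
  change ExteriorAlgebra.ιMulti ℝ (n + m) (Fin.append y x) =
    ((-1 : ℝ) ^ (m * n)) • ExteriorAlgebra.ιMulti ℝ (m + n) (Fin.append x y)
  rw [key, key, prod_map_ι_mul_prod_map_ι, List.length_ofFn, List.length_ofFn, mul_comm n m]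

theorem coord_natAdd_castAdd {m n : ℕ} (b : Basis (Fin (m + n)) ℝ V) (i : Fin n) (j : Fin m) :
    b.coord (Fin.natAdd m i) (b (Fin.castAdd n j)) = 0 := by
  rw [Basis.coord_apply, Basis.repr_self, Finsupp.single_apply, if_neg]
  intro h
  have := congrArg Fin.val h
  simp only [Fin.val_castAdd, Fin.val_natAdd] at this
  omega

theorem reindex_finAddFlip_castAdd {m n : ℕ} (b : Basis (Fin (m + n)) ℝ V) (i : Fin n) :
    b.reindex finAddFlip (Fin.castAdd m i) = b (Fin.natAdd m i) := by
  rw [Basis.reindex_apply, ← finAddFlip_apply_natAdd, Equiv.symm_apply_apply]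

theorem reindex_finAddFlip_natAdd {m n : ℕ} (b : Basis (Fin (m + n)) ℝ V) (i : Fin m) :
    b.reindex finAddFlip (Fin.natAdd n i) = b (Fin.castAdd n i) := by
  rw [Basis.reindex_apply, ← finAddFlip_apply_castAdd, Equiv.symm_apply_apply]

/-- `finAddFlip` exchanges the two blocks of indices. Every sign caused by the reversed order of
blocks in the dual snake sequence comes from here. -/
theorem basisWedge_reindex_finAddFlip {m n : ℕ} (b : Basis (Fin (m + n)) ℝ V) :
    basisWedge (b.reindex finAddFlip) = ((-1 : ℝ) ^ (m * n)) • basisWedge b := by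
  have h1 : (b : Fin (m + n) → V) =
      Fin.append (fun i => b (Fin.castAdd n i)) (fun i => b (Fin.natAdd m i)) := by
    funext i
    refine Fin.addCases (fun i => ?_) (fun i => ?_) i <;> simp
  have h2 : (b.reindex finAddFlip : Fin (n + m) → V) =
      Fin.append (fun i => b (Fin.natAdd m i)) (fun i => b (Fin.castAdd n i)) := by
    funext i
    refine Fin.addCases (fun i => ?_) (fun i => ?_) i
    · rw [reindex_finAddFlip_castAdd, Fin.append_left]
    · rw [reindex_finAddFlip_natAdd, Fin.append_right]
  have h := topWedge_append_swap (basis_card_eq b) (basis_card_eq (b.reindex finAddFlip))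
    (fun i => b (Fin.castAdd n i)) (fun i => b (Fin.natAdd m i))
  rw [← h1, ← h2] at h
  exact h

/-- The second block of `b` is a lift of `y`, and `∧` may be computed with any lift, so no sign or
determinant appears. -/
theorem wedge_basisWedge [FiniteDimensional ℝ V] {f : V' →ₗ[ℝ] V} {g : V →ₗ[ℝ] V''}
    (hf : Function.Injective f) (hfg : Function.Exact f g) (hg : Function.Surjective g) {m n : ℕ}
    (x : Basis (Fin m) ℝ V') (y : Basis (Fin n) ℝ V'') (b : Basis (Fin (m + n)) ℝ V)
    (hx : ∀ i, f (x i) = b (Fin.castAdd n i)) (hy : ∀ i, g (b (Fin.natAdd m i)) = y i) :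
    wedge hf hfg hg (basisWedge x ⊗ₜ basisWedge y) = basisWedge b := by
  have h := wedge_topWedge hf hfg hg (basis_card_eq x) (basis_card_eq y) x
    (fun i => b (Fin.natAdd m i))
  have h1 : (b : Fin (m + n) → V) = Fin.append (f ∘ x) (fun i => b (Fin.natAdd m i)) := by
    funext i
    refine Fin.addCases (fun i => ?_) (fun i => ?_) i <;> simp [hx]
  have h2 : (y : Fin n → V'') = g ∘ fun i => b (Fin.natAdd m i) := funext fun i => (hy i).symm
  rw [← h1, ← h2] at h
  exact h

/-- Bases of the outer terms of a short exact sequence come from a basis of the middle term. -/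
theorem exists_basis_of_exact {f : V' →ₗ[ℝ] V} {g : V →ₗ[ℝ] V''}
    (hf : Function.Injective f) (hfg : Function.Exact f g) (hg : Function.Surjective g) {m n : ℕ}
    (x : Basis (Fin m) ℝ V') (y : Basis (Fin n) ℝ V'') :
    ∃ b : Basis (Fin (m + n)) ℝ V, (∀ i, f (x i) = b (Fin.castAdd n i)) ∧
      ∀ i, g (b (Fin.natAdd m i)) = y i := by
  refine ⟨((x.prod y).map (splitEquiv hf hfg hg)).reindex finSumFinEquiv, fun i => ?_,
    fun i => ?_⟩
  · simp [splitEquiv_apply]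
  · simp [splitEquiv_apply, apply_section]

/-- If a linear map kills the first part of a basis and maps the second part to the first part of
a basis, the latter is a basis of its range. -/
theorem exists_basis_range (f : V →ₗ[ℝ] W) {a b c : ℕ} (p : Basis (Fin (a + b)) ℝ V)
    (q : Basis (Fin (b + c)) ℝ W) (h0 : ∀ i, f (p (Fin.castAdd b i)) = 0)
    (h1 : ∀ i, f (p (Fin.natAdd a i)) = q (Fin.castAdd c i)) :
    ∃ u : Basis (Fin b) ℝ (LinearMap.range f), ∀ i, (u i : W) = q (Fin.castAdd c i) := by
  let u : Fin b → LinearMap.range f := fun i => ⟨q (Fin.castAdd c i), ⟨_, h1 i⟩⟩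
  have hu : LinearIndependent ℝ u := by
    refine LinearIndependent.of_comp (LinearMap.range f).subtype ?_
    exact q.linearIndependent.comp _ (Fin.castAdd_injective b c)
  refine ⟨Basis.mk hu ?_, fun i => by rw [Basis.mk_apply]⟩
  rintro ⟨_, x, rfl⟩ -
  have hx : x ∈ Submodule.span ℝ (Set.range p) := by rw [p.span_eq]; trivial
  -- Spanning: the range is generated by the images of `p`, which are zero on the first block and
  -- the vectors `u i` on the second.
  have hle : Submodule.span ℝ (Set.range p) ≤
      (Submodule.span ℝ (Set.range u)).comap f.rangeRestrict := by
    rw [Submodule.span_le]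
    rintro _ ⟨i, rfl⟩
    refine Fin.addCases (fun i => ?_) (fun i => ?_) i
    · have : f.rangeRestrict (p (Fin.castAdd b i)) = 0 := Subtype.ext (h0 i)
      rw [SetLike.mem_coe, Submodule.mem_comap, this]
      exact Submodule.zero_mem _
    · have : f.rangeRestrict (p (Fin.natAdd a i)) = u i := Subtype.ext (h1 i)
      rw [SetLike.mem_coe, Submodule.mem_comap, this]
      exact Submodule.subset_span ⟨i, rfl⟩
  exact hle hx

theorem smul_smul_tmul_smul {V W : Type*} [AddCommMonoid V] [Module ℝ V] [AddCommMonoid W]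
    [Module ℝ W] (a p q : ℝ) (x : V) (y : W) :
    a • ((p • x) ⊗ₜ[ℝ] (q • y)) = (a * (p * q)) • (x ⊗ₜ[ℝ] y) := by
  rw [TensorProduct.smul_tmul_smul, smul_smul]

/-- The isomorphism `𝒫` on the generators of dual bases. -/
theorem pairing_dualBasis [FiniteDimensional ℝ V] {n : ℕ} (b : Basis (Fin n) ℝ V) :
    pairing V (basisWedge b.dualBasis) (basisWedge b) = (-1 : ℝ) ^ n.choose 2 := by
  refine (pairing_topWedge (basis_card_eq b) b.dualBasis b).trans ?_
  have : (Matrix.of fun i j => b.dualBasis i (b j)) = 1 := by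
    ext i j
    simp [Matrix.one_apply, Finsupp.single_apply, eq_comm]
  rw [this, Matrix.det_one, mul_one]

/-- A functional on a line is determined by being `1` at a given vector, so `ω` is the element
written `ℓ*` for the generator `ℓ` of `b`; only the sign in the definition of `𝒫` remains. -/
theorem pairing_dualBasis_eq [FiniteDimensional ℝ V] {n : ℕ} (b : Basis (Fin n) ℝ V)
    {ω : Dual ℝ (TopExt V)} (hω : ω (basisWedge b) = 1) :
    pairing V (basisWedge b.dualBasis) = ((-1 : ℝ) ^ n.choose 2) • ω := by
  have h : ((-1 : ℝ) ^ n.choose 2) • pairing V (basisWedge b.dualBasis) = ω := by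
    refine line_dual_ext (finrank_topExt V) (x := basisWedge b) ?_ hω
    rw [LinearMap.smul_apply, pairing_dualBasis, smul_eq_mul, neg_one_pow_mul_self]
  rw [← h, smul_smul, neg_one_pow_mul_self,
    one_smul]

theorem pairing_symm_eq [FiniteDimensional ℝ V] {n : ℕ} (b : Basis (Fin n) ℝ V)
    {ω : Dual ℝ (TopExt V)} (hω : ω (basisWedge b) = 1) :
    (pairing V).symm ω = ((-1 : ℝ) ^ n.choose 2) • basisWedge b.dualBasis := by
  rw [LinearEquiv.symm_apply_eq, map_smul, pairing_dualBasis_eq b hω, smul_smul, neg_one_pow_mul_self,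
    one_smul]

end BasisWedges

/-! ### Dual bases and the dualization isomorphism -/

section DualBases

variable {X Y : Type*} [NormedAddCommGroup X] [NormedSpace ℝ X]
  [NormedAddCommGroup Y] [NormedSpace ℝ Y]

/-- The basis of `κ(D*)` dual to a basis of `𝔠(D)`. -/
def kerDualBasis {D : X →L[ℝ] Y} (hD : D.IsFredholm) {n : ℕ} (c : Basis (Fin n) ℝ (Coker D)) :
    Basis (Fin n) ℝ (Ker (dualOp D)) :=
  c.dualBasis.map (cokerDualEquiv hD)

theorem kerDualBasis_apply {D : X →L[ℝ] Y} (hD : D.IsFredholm) {n : ℕ}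
    (c : Basis (Fin n) ℝ (Coker D)) (i : Fin n) (y : Y) :
    (kerDualBasis hD c i : StrongDual ℝ Y) y = c.coord i ((Im D).mkQ y) := by
  rw [kerDualBasis, Basis.map_apply, Basis.coe_dualBasis]
  rfl

variable [CompleteSpace X] [CompleteSpace Y]

/-- The basis of `𝔠(D*)` dual to a basis of `κ(D)`. -/
def cokerDualBasis {D : X →L[ℝ] Y} (hD : D.IsFredholm) {n : ℕ} (k : Basis (Fin n) ℝ (Ker D)) :
    Basis (Fin n) ℝ (Coker (dualOp D)) :=
  haveI : FiniteDimensional ℝ (Coker (dualOp D)) := (isFredholm_dualOp hD).finite_coker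
  (k.map (kerDualEquiv hD)).dualBasis.map (evalEquiv ℝ (Coker (dualOp D))).symm

/-- `𝒟_D` maps `κ(D)` to the dual of `𝔠(D*)`, so a basis of `𝔠(D*)` itself has to be a predual one,
obtained through the double dual. This confirms that it is the right one. -/
theorem cokerDualBasis_dualBasis {D : X →L[ℝ] Y} (hD : D.IsFredholm) {n : ℕ}
    (k : Basis (Fin n) ℝ (Ker D)) :
    (cokerDualBasis hD k).dualBasis = k.map (kerDualEquiv hD) := by
  have : FiniteDimensional ℝ (Coker (dualOp D)) := (isFredholm_dualOp hD).finite_coker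
  refine Basis.eq_of_apply_eq fun j => Basis.ext (cokerDualBasis hD k) fun i => ?_
  rw [Basis.dualBasis_apply_self]
  have h : evalEquiv ℝ (Coker (dualOp D)) (cokerDualBasis hD k i) =
      (k.map (kerDualEquiv hD)).dualBasis i := by
    rw [cokerDualBasis, Basis.map_apply, LinearEquiv.apply_symm_apply]
  -- Evaluation of the double dual at `𝒟_D (k j)` turns the definition of the predual basis into the
  -- required Kronecker delta, with the indices in the other order.
  have h' := LinearMap.congr_fun h (k.map (kerDualEquiv hD) j)
  rw [Basis.dualBasis_apply_self] at h'
  refine Eq.trans ?_ h'.symm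
  simp only [eq_comm]

theorem kerDualMap_cokerDualBasis {D : X →L[ℝ] Y} (hD : D.IsFredholm) {n : ℕ}
    (k : Basis (Fin n) ℝ (Ker D)) (x : Ker D) (i : Fin n) :
    kerDualMap D x (cokerDualBasis hD k i) = k.coord i x := by
  have h : (kerDualMap D).flip (cokerDualBasis hD k i) = k.coord i := by
    refine Basis.ext k fun j => ?_
    have h' := Basis.dualBasis_apply_self (cokerDualBasis hD k) j i
    rw [cokerDualBasis_dualBasis] at h'
    refine Eq.trans h' ?_
    rw [Basis.coord_apply, Basis.repr_self, Finsupp.single_apply]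
    simp only [eq_comm]
  exact LinearMap.congr_fun h x

/-- The dualization isomorphism on the generators given by bases. -/
theorem dualization_basisWedge {D : X →L[ℝ] Y} (hD : D.IsFredholm) {m n : ℕ}
    (k : Basis (Fin m) ℝ (Ker D)) (c : Basis (Fin n) ℝ (Coker D))
    {α : Dual ℝ (TopExt (Coker D))} {ω : Dual ℝ (TopExt (Coker (dualOp D)))}
    (hα : α (basisWedge c) = 1) (hω : ω (basisWedge (cokerDualBasis hD k)) = 1) :
    dualization hD (basisWedge k ⊗ₜ α) =
      ((-1 : ℝ) ^ (index D * n + n.choose 2 + m.choose 2)) •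
        (basisWedge (kerDualBasis hD c) ⊗ₜ[ℝ] ω) := by
  have : FiniteDimensional ℝ (Coker D) := hD.finite_coker
  have : FiniteDimensional ℝ (Coker (dualOp D)) := (isFredholm_dualOp hD).finite_coker
  have h1 : topMap (cokerDualEquiv hD) ((pairing (Coker D)).symm α) =
      ((-1 : ℝ) ^ n.choose 2) • basisWedge (kerDualBasis hD c) := by
    rw [pairing_symm_eq c hα, map_smul, topMap_basisWedge, kerDualBasis]
  have h2 : pairing (Coker (dualOp D)) (topMap (kerDualEquiv hD) (basisWedge k)) =
      ((-1 : ℝ) ^ m.choose 2) • ω := by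
    rw [topMap_basisWedge, ← cokerDualBasis_dualBasis hD k, pairing_dualBasis_eq _ hω]
  -- The three signs: the one in the definition of dualization, `𝒫⁻¹` on the `n`-dimensional
  -- cokernel, and `𝒫` on the `m`-dimensional kernel.
  have h3 : ((-1 : ℝ) ^ (index D * finrank ℝ (Coker D))) *
      ((-1 : ℝ) ^ n.choose 2 * (-1 : ℝ) ^ m.choose 2) =
        (-1 : ℝ) ^ (index D * n + n.choose 2 + m.choose 2) := by
    have hn : ((n : ℕ) : ℤ) = finrank ℝ (Coker D) := congrArg _ (basis_card_eq c)
    rw [hn, zpow_add₀ (by norm_num), zpow_add₀ (by norm_num), zpow_natCast, zpow_natCast,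
      mul_assoc]
  rw [dualization_tmul, h1, h2]
  refine (smul_smul_tmul_smul _ _ _ _ _).trans ?_
  exact congrArg (fun r : ℝ => r • (basisWedge (kerDualBasis hD c) ⊗ₜ[ℝ] ω)) h3

end DualBases

/-! ### Bases adapted to the snake sequence -/

namespace ExactTriple

variable {X Y X' Y' X'' Y'' : Type*}
  [NormedAddCommGroup X] [NormedSpace ℝ X] [NormedAddCommGroup Y] [NormedSpace ℝ Y]
  [NormedAddCommGroup X'] [NormedSpace ℝ X'] [NormedAddCommGroup Y'] [NormedSpace ℝ Y']
  [NormedAddCommGroup X''] [NormedSpace ℝ X''] [NormedAddCommGroup Y''] [NormedSpace ℝ Y'']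

/-- Bases of the six spaces of the snake sequence, compatible with its maps: each map kills the
first part of its basis and sends the second part to the first part of the next basis. -/
structure AdaptedBases (t : ExactTriple X Y X' Y' X'' Y'') (a b c d e : ℕ) where
  ker' : Basis (Fin a) ℝ (Ker t.D')
  ker : Basis (Fin (a + b)) ℝ (Ker t.D)
  ker'' : Basis (Fin (b + c)) ℝ (Ker t.D'')
  coker' : Basis (Fin (c + d)) ℝ (Coker t.D')
  coker : Basis (Fin (d + e)) ℝ (Coker t.D)
  coker'' : Basis (Fin e) ℝ (Coker t.D'')
  kerI_ker' : ∀ i, t.kerI (ker' i) = ker (Fin.castAdd b i)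
  kerJ_ker : ∀ i, t.kerJ (ker (Fin.natAdd a i)) = ker'' (Fin.castAdd c i)
  connecting_ker'' : ∀ i, t.connecting (ker'' (Fin.natAdd b i)) = coker' (Fin.castAdd d i)
  cokerI_coker' : ∀ i, t.cokerI (coker' (Fin.natAdd c i)) = coker (Fin.castAdd e i)
  cokerJ_coker : ∀ i, t.cokerJ (coker (Fin.natAdd d i)) = coker'' i

/-- The six-term sequence splits into four short exact ones; in each, a basis of the subspace is
completed by lifts of a basis of the quotient. -/
theorem exists_adaptedBases (t : ExactTriple X Y X' Y' X'' Y'') :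
    ∃ a b c d e : ℕ, Nonempty (t.AdaptedBases a b c d e) := by
  have : FiniteDimensional ℝ (Ker t.D') := t.fredholm'.finite_ker
  -- Each image is the quotient in one short exact sequence and the subspace in the next. Using one
  -- fixed basis for both roles is what makes consecutive bases match.
  let u := finBasis ℝ (LinearMap.range t.kerJ)
  let v := finBasis ℝ (LinearMap.range t.connecting)
  let w := finBasis ℝ (LinearMap.range t.cokerI)
  obtain ⟨k, hk, hk'⟩ := exists_basis_of_exact (f := t.kerI) (g := t.kerJ.rangeRestrict)
    t.kerI_injective (fun x => by rw [← t.exact_kerI_kerJ x]; exact Subtype.ext_iff)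
    t.kerJ.surjective_rangeRestrict (finBasis ℝ (Ker t.D')) u
  obtain ⟨k'', hk'', hv⟩ := exists_basis_of_exact (f := (LinearMap.range t.kerJ).subtype)
    (g := t.connecting.rangeRestrict) Subtype.val_injective
    (fun x => Subtype.ext_iff.trans ((t.exact_kerJ_connecting x).trans (by simp)))
    t.connecting.surjective_rangeRestrict u v
  obtain ⟨c', hc', hw⟩ := exists_basis_of_exact (f := (LinearMap.range t.connecting).subtype)
    (g := t.cokerI.rangeRestrict) Subtype.val_injective
    (fun x => Subtype.ext_iff.trans ((t.exact_connecting_cokerI x).trans (by simp)))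
    t.cokerI.surjective_rangeRestrict v w
  obtain ⟨c, hc, hy⟩ := exists_basis_of_exact (f := (LinearMap.range t.cokerI).subtype)
    (g := t.cokerJ) Subtype.val_injective
    (fun x => (t.exact_cokerI_cokerJ x).trans (by simp))
    t.cokerJ_surjective w (finBasis ℝ (Coker t.D''))
  exact ⟨_, _, _, _, _, ⟨{
    ker' := finBasis ℝ (Ker t.D')
    ker := k
    ker'' := k''
    coker' := c'
    coker := c
    coker'' := finBasis ℝ (Coker t.D'')
    kerI_ker' := hk
    kerJ_ker := fun i => (congrArg Subtype.val (hk' i)).trans (hk'' i)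
    connecting_ker'' := fun i => (congrArg Subtype.val (hv i)).trans (hc' i)
    cokerI_coker' := fun i => (congrArg Subtype.val (hw i)).trans (hc i)
    cokerJ_coker := hy }⟩⟩

namespace AdaptedBases

variable {t : ExactTriple X Y X' Y' X'' Y''} {a b c d e : ℕ}

theorem index_eq (β : t.AdaptedBases a b c d e) : index t.D = a + b - (d + e) := by
  rw [index, ← basis_card_eq β.ker, ← basis_card_eq β.coker]
  push_cast
  ring

theorem index_eq' (β : t.AdaptedBases a b c d e) : index t.D' = a - (c + d) := by
  rw [index, ← basis_card_eq β.ker', ← basis_card_eq β.coker']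
  push_cast
  ring

theorem index_eq'' (β : t.AdaptedBases a b c d e) : index t.D'' = b + c - e := by
  rw [index, ← basis_card_eq β.ker'', ← basis_card_eq β.coker'']
  push_cast
  ring

/-- The block shared by two consecutive bases is a basis of the image between them. This and the two
analogues below supply the factors `u`, `v`, `w` in the formula for `Ψ_t`. -/
theorem exists_basis_range_kerJ (β : t.AdaptedBases a b c d e) :
    ∃ u : Basis (Fin b) ℝ (LinearMap.range t.kerJ),
      ∀ i, (u i : Ker t.D'') = β.ker'' (Fin.castAdd c i) :=
  exists_basis_range t.kerJ β.ker β.ker''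
    (fun i => by rw [← β.kerI_ker', t.exact_kerI_kerJ.apply_apply_eq_zero]) β.kerJ_ker

theorem exists_basis_range_connecting (β : t.AdaptedBases a b c d e) :
    ∃ v : Basis (Fin c) ℝ (LinearMap.range t.connecting),
      ∀ i, (v i : Coker t.D') = β.coker' (Fin.castAdd d i) :=
  exists_basis_range t.connecting β.ker'' β.coker'
    (fun i => by rw [← β.kerJ_ker, t.exact_kerJ_connecting.apply_apply_eq_zero])
    β.connecting_ker''

theorem exists_basis_range_cokerI (β : t.AdaptedBases a b c d e) :
    ∃ w : Basis (Fin d) ℝ (LinearMap.range t.cokerI),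
      ∀ i, (w i : Coker t.D) = β.coker (Fin.castAdd e i) :=
  exists_basis_range t.cokerI β.coker' β.coker
    (fun i => by rw [← β.connecting_ker'', t.exact_connecting_cokerI.apply_apply_eq_zero])
    β.cokerI_coker'

theorem signExp_eq (β : t.AdaptedBases a b c d e) :
    t.signExp = (b + c - e) * (c + d) + (d + e) * c := by
  obtain ⟨v, -⟩ := β.exists_basis_range_connecting
  rw [signExp, β.index_eq'', ← basis_card_eq β.coker', ← basis_card_eq β.coker,
    ← basis_card_eq v]
  push_cast
  ring

/-- The isomorphism `Ψ_t` on the generators given by adapted bases. -/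
theorem Psi_basisWedge (β : t.AdaptedBases a b c d e) {α : Dual ℝ (TopExt (Coker t.D'))}
    {γ : Dual ℝ (TopExt (Coker t.D''))} {ω : Dual ℝ (TopExt (Coker t.D))}
    (hα : α (basisWedge β.coker') = 1) (hγ : γ (basisWedge β.coker'') = 1)
    (hω : ω (basisWedge β.coker) = 1) :
    t.Psi ((basisWedge β.ker' ⊗ₜ α) ⊗ₜ (basisWedge β.ker'' ⊗ₜ γ)) =
      ((-1 : ℝ) ^ t.signExp) • (basisWedge β.ker ⊗ₜ[ℝ] ω) := by
  obtain ⟨u, hu⟩ := β.exists_basis_range_kerJ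
  obtain ⟨v, hv⟩ := β.exists_basis_range_connecting
  obtain ⟨w, hw⟩ := β.exists_basis_range_cokerI
  have h1 : t.wedgeKer (basisWedge β.ker' ⊗ₜ basisWedge u) = basisWedge β.ker :=
    wedge_basisWedge _ _ _ _ _ _ β.kerI_ker'
      fun i => Subtype.ext ((β.kerJ_ker i).trans (hu i).symm)
  have h2 : t.wedgeKer'' (basisWedge u ⊗ₜ basisWedge v) = basisWedge β.ker'' :=
    wedge_basisWedge _ _ _ _ _ _ hu
      fun i => Subtype.ext ((β.connecting_ker'' i).trans (hv i).symm)
  have h3 : t.wedgeCoker' (basisWedge v ⊗ₜ basisWedge w) = basisWedge β.coker' :=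
    wedge_basisWedge _ _ _ _ _ _ hv
      fun i => Subtype.ext ((β.cokerI_coker' i).trans (hw i).symm)
  have h4 : t.wedgeCoker (basisWedge w ⊗ₜ basisWedge β.coker'') = basisWedge β.coker :=
    wedge_basisWedge _ _ _ _ _ _ hw β.cokerJ_coker
  have h := t.Psi_apply (basisWedge β.ker') (basisWedge u) (basisWedge v) (basisWedge w)
    (basisWedge β.coker'') α γ ω (h3.symm ▸ hα) hγ (h4.symm ▸ hω)
  rw [h1, h2] at h
  exact h

end AdaptedBases

/-! ### The snake sequence of the dual triple is the transposed one -/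

section Dual

variable [CompleteSpace X] [CompleteSpace Y] [CompleteSpace X'] [CompleteSpace Y']
  [CompleteSpace X''] [CompleteSpace Y'']
  {t : ExactTriple X Y X' Y' X'' Y''} {a b c d e : ℕ}

/-- In adapted bases `cokerJ` is the block matrix `(0 | 1)`, and `t.dual.kerI` is its transpose, so
dual basis vectors go to those of the second block. The four analogues below rest on the same
computation for the other maps. -/
theorem AdaptedBases.dual_kerI (β : t.AdaptedBases a b c d e) (i : Fin e) :
    t.dual.kerI (kerDualBasis t.fredholm'' β.coker'' i) =
      kerDualBasis t.fredholm β.coker (Fin.natAdd d i) := by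
  refine Subtype.ext (ContinuousLinearMap.ext fun y => ?_)
  refine (kerDualBasis_apply t.fredholm'' β.coker'' i (t.jY y)).trans
    (Eq.trans ?_ (kerDualBasis_apply t.fredholm β.coker (Fin.natAdd d i) y).symm)
  change (β.coker''.coord i ∘ₗ t.cokerJ) ((Im t.D).mkQ y) = _
  refine LinearMap.congr_fun (β.coker.ext fun j => ?_) _
  refine Fin.addCases (fun j => ?_) (fun j => ?_) j
  -- The first block comes from the preceding term, so exactness kills it. The backward rewrite also
  -- affects the right-hand side, which the last rewrite restores.
  · rw [LinearMap.comp_apply, ← β.cokerI_coker', t.exact_cokerI_cokerJ.apply_apply_eq_zero,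
      β.cokerI_coker']
    simp only [map_zero, coord_natAdd_castAdd]
  · rw [LinearMap.comp_apply, β.cokerJ_coker]
    simp [Finsupp.single_apply]

theorem AdaptedBases.dual_kerJ (β : t.AdaptedBases a b c d e) (i : Fin d) :
    t.dual.kerJ (kerDualBasis t.fredholm β.coker (Fin.castAdd e i)) =
      kerDualBasis t.fredholm' β.coker' (Fin.natAdd c i) := by
  refine Subtype.ext (ContinuousLinearMap.ext fun y => ?_)
  refine (kerDualBasis_apply t.fredholm β.coker (Fin.castAdd e i) (t.iY y)).trans
    (Eq.trans ?_ (kerDualBasis_apply t.fredholm' β.coker' (Fin.natAdd c i) y).symm)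
  change (β.coker.coord (Fin.castAdd e i) ∘ₗ t.cokerI) ((Im t.D').mkQ y) = _
  refine LinearMap.congr_fun (β.coker'.ext fun j => ?_) _
  refine Fin.addCases (fun j => ?_) (fun j => ?_) j
  · rw [LinearMap.comp_apply, ← β.connecting_ker'',
      t.exact_connecting_cokerI.apply_apply_eq_zero, β.connecting_ker'']
    simp only [map_zero, coord_natAdd_castAdd]
  · rw [LinearMap.comp_apply, β.cokerI_coker']
    simp [Finsupp.single_apply]

/-- Elements of `𝔠(D*)` that agree as functionals on `κ(D)` are equal. -/
theorem coker_dualOp_ext {D : X →L[ℝ] Y} (hD : D.IsFredholm) {p q : Coker (dualOp D)}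
    (h : ∀ x : Ker D, kerDualMap D x p = kerDualMap D x q) : p = q := by
  rw [← sub_eq_zero]
  refine (Module.forall_dual_apply_eq_zero_iff ℝ _).1 fun φ => ?_
  obtain ⟨x, rfl⟩ := (kerDualMap_bijective hD).2 φ
  rw [map_sub, h, sub_self]

/-- For a representative `α` of `p`, both sides are `α (jX x)`. -/
theorem kerDualMap_dual_cokerI (x : Ker t.D) (p : Coker (dualOp t.D'')) :
    kerDualMap t.D x (t.dual.cokerI p) = kerDualMap t.D'' (t.kerJ x) p := by
  obtain ⟨α, rfl⟩ := Submodule.mkQ_surjective _ p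
  rfl

theorem kerDualMap_dual_cokerJ (x : Ker t.D') (p : Coker (dualOp t.D)) :
    kerDualMap t.D' x (t.dual.cokerJ p) = kerDualMap t.D (t.kerI x) p := by
  obtain ⟨α, rfl⟩ := Submodule.mkQ_surjective _ p
  rfl

/-- The connecting homomorphism of the dual triple is dual to the one of the triple. -/
theorem kerDualMap_dual_connecting (x'' : Ker t.D'') (p : Dual ℝ (Coker t.D')) :
    kerDualMap t.D'' x'' (t.dual.connecting (cokerDualMap t.fredholm' p)) =
      p (t.connecting x'') := by
  obtain ⟨x, hx⟩ := t.jX_surjective x''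
  obtain ⟨y', hy'⟩ := (t.exact_Y (t.D x)).1 (by rw [← t.comm_j_apply, hx]; exact x''.2)
  -- Data for the dual connecting map: `β` extends the functional on `Y'` along `iY`. Then `β ∘ D`
  -- vanishes on the image of `iX`, because `p` vanishes on `Im D'`, and so it factors as `γ ∘ jX`.
  obtain ⟨β, hβ⟩ := dualOp_surjective t.iY_injective t.exact_Y
    (cokerDualMap t.fredholm' p : StrongDual ℝ Y')
  obtain ⟨γ, hγ⟩ := (exact_dualOp t.exact_X t.jX_surjective (dualOp t.D β)).1 (by
    refine ContinuousLinearMap.ext fun x' => ?_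
    change β (t.D (t.iX x')) = 0
    rw [t.comm_i_apply]
    refine (DFunLike.congr_fun hβ (t.D' x')).trans ?_
    rw [cokerDualMap_apply]
    have h0 : (Im t.D').mkQ (t.D' x') = 0 := (Submodule.Quotient.mk_eq_zero _).2 ⟨x', rfl⟩
    rw [h0, map_zero])
  rw [t.connecting_apply x'' x hx y' hy',
    t.dual.connecting_apply (cokerDualMap t.fredholm' p) β hβ γ hγ]
  -- The chain is `γ x'' = γ (jX x) = β (D x) = β (iY y') = p (y' + Im D')`.
  change γ (x'' : X'') = _
  rw [← hx]
  refine (DFunLike.congr_fun hγ x).trans ?_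
  rw [dualOp_apply, ← hy']
  exact DFunLike.congr_fun hβ y'

/-- Elements of `𝔠(D''*)` are tested against `κ(D'')`, where the dual connecting map becomes
composition with `δ`. -/
theorem AdaptedBases.dual_connecting (β : t.AdaptedBases a b c d e) (i : Fin c) :
    t.dual.connecting (kerDualBasis t.fredholm' β.coker' (Fin.castAdd d i)) =
      cokerDualBasis t.fredholm'' β.ker'' (Fin.natAdd b i) := by
  refine coker_dualOp_ext t.fredholm'' fun x => ?_
  rw [kerDualMap_cokerDualBasis]
  have h : kerDualBasis t.fredholm' β.coker' (Fin.castAdd d i) =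
      cokerDualMap t.fredholm' (β.coker'.coord (Fin.castAdd d i)) := by
    rw [kerDualBasis, Basis.map_apply, Basis.coe_dualBasis]
    rfl
  rw [h]
  refine (kerDualMap_dual_connecting x _).trans ?_
  change (β.coker'.coord (Fin.castAdd d i) ∘ₗ t.connecting) x = _
  refine LinearMap.congr_fun (β.ker''.ext fun j => ?_) _
  refine Fin.addCases (fun j => ?_) (fun j => ?_) j
  · rw [LinearMap.comp_apply, ← β.kerJ_ker, t.exact_kerJ_connecting.apply_apply_eq_zero,
      β.kerJ_ker]
    simp only [map_zero, coord_natAdd_castAdd]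
  · rw [LinearMap.comp_apply, β.connecting_ker'']
    simp [Finsupp.single_apply]

theorem AdaptedBases.dual_cokerI (β : t.AdaptedBases a b c d e) (i : Fin b) :
    t.dual.cokerI (cokerDualBasis t.fredholm'' β.ker'' (Fin.castAdd c i)) =
      cokerDualBasis t.fredholm β.ker (Fin.natAdd a i) := by
  refine coker_dualOp_ext t.fredholm fun x => ?_
  rw [kerDualMap_cokerDualBasis]
  refine (kerDualMap_dual_cokerI x _).trans ?_
  rw [kerDualMap_cokerDualBasis]
  change (β.ker''.coord (Fin.castAdd c i) ∘ₗ t.kerJ) x = _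
  refine LinearMap.congr_fun (β.ker.ext fun j => ?_) _
  refine Fin.addCases (fun j => ?_) (fun j => ?_) j
  · rw [LinearMap.comp_apply, ← β.kerI_ker', t.exact_kerI_kerJ.apply_apply_eq_zero,
      β.kerI_ker']
    simp only [map_zero, coord_natAdd_castAdd]
  · rw [LinearMap.comp_apply, β.kerJ_ker]
    simp [Finsupp.single_apply]

theorem AdaptedBases.dual_cokerJ (β : t.AdaptedBases a b c d e) (i : Fin a) :
    t.dual.cokerJ (cokerDualBasis t.fredholm β.ker (Fin.castAdd b i)) =
      cokerDualBasis t.fredholm' β.ker' i := by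
  refine coker_dualOp_ext t.fredholm' fun x => ?_
  rw [kerDualMap_cokerDualBasis]
  refine (kerDualMap_dual_cokerJ x _).trans ?_
  rw [kerDualMap_cokerDualBasis]
  change (β.ker.coord (Fin.castAdd b i) ∘ₗ t.kerI) x = _
  refine LinearMap.congr_fun (β.ker'.ext fun j => ?_) _
  rw [LinearMap.comp_apply, β.kerI_ker']
  simp [Finsupp.single_apply]

/-- The bases dual to adapted bases of a triple are adapted to the dual triple. -/
def AdaptedBases.dual (β : t.AdaptedBases a b c d e) : t.dual.AdaptedBases e d c b a where
  ker' := kerDualBasis t.fredholm'' β.coker''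
  ker := (kerDualBasis t.fredholm β.coker).reindex finAddFlip
  ker'' := (kerDualBasis t.fredholm' β.coker').reindex finAddFlip
  coker' := (cokerDualBasis t.fredholm'' β.ker'').reindex finAddFlip
  coker := (cokerDualBasis t.fredholm β.ker).reindex finAddFlip
  coker'' := cokerDualBasis t.fredholm' β.ker'
  kerI_ker' i := (β.dual_kerI i).trans (reindex_finAddFlip_castAdd _ i).symm
  kerJ_ker i := (congrArg t.dual.kerJ (reindex_finAddFlip_natAdd _ i)).trans
    ((β.dual_kerJ i).trans (reindex_finAddFlip_castAdd _ i).symm)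
  connecting_ker'' i := (congrArg t.dual.connecting (reindex_finAddFlip_natAdd _ i)).trans
    ((β.dual_connecting i).trans (reindex_finAddFlip_castAdd _ i).symm)
  cokerI_coker' i := (congrArg t.dual.cokerI (reindex_finAddFlip_natAdd _ i)).trans
    ((β.dual_cokerI i).trans (reindex_finAddFlip_castAdd _ i).symm)
  cokerJ_coker i := (congrArg t.dual.cokerJ (reindex_finAddFlip_natAdd _ i)).trans
    (β.dual_cokerJ i)

end Dual

end ExactTriple

/-! ### Sign bookkeeping and the parity identity -/

section Lines

variable {A B C E M N : Type*} [AddCommGroup A] [Module ℝ A] [AddCommGroup B] [Module ℝ B]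
  [AddCommGroup C] [Module ℝ C] [AddCommGroup E] [Module ℝ E] [AddCommGroup M] [Module ℝ M]
  [AddCommGroup N] [Module ℝ N]

/-- Transfers a formula for `Ψ` from generators with exchanged blocks to the original ones; `p`, `q`
are signs on the source and `r`, `s` on the target. -/
theorem map_fourfold_of_signs (F : (A ⊗[ℝ] B) ⊗[ℝ] (C ⊗[ℝ] E) →ₗ[ℝ] M ⊗[ℝ] N)
    {p q k r s : ℝ} (hp : p * p = 1) (hq : q * q = 1) {x : A} {y : B} {u u' : C} {v : E}
    {m m' : M} {n : N} (hu : u' = q • u) (hm : m' = r • m)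
    (h : F ((x ⊗ₜ (p • y)) ⊗ₜ (u' ⊗ₜ v)) = k • (m' ⊗ₜ[ℝ] (s • n))) :
    F ((x ⊗ₜ y) ⊗ₜ (u ⊗ₜ v)) = (p * q * k * r * s) • (m ⊗ₜ[ℝ] n) := by
  subst hu hm
  simp only [TensorProduct.tmul_smul, ← TensorProduct.smul_tmul', map_smul, smul_smul] at h
  -- Since `p` and `q` square to `1`, multiplying by `p * q` removes them from the source.
  have h' := congrArg (fun w => (p * q) • w) h
  simp only [smul_smul] at h'
  rw [show p * q * (q * p) = (p * p) * (q * q) by ring, hp, hq, one_mul, one_smul] at h'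
  rw [h']
  congr 1
  ring

end Lines

theorem neg_one_zpow_eq_of_even {m n : ℤ} (h : Even (m - n)) : (-1 : ℝ) ^ m = (-1) ^ n := by
  have : m = (m - n) + n := by ring
  rw [this, zpow_add₀ (by norm_num), h.neg_one_zpow, one_mul]

theorem choose_two_add (m n : ℕ) :
    (((m + n).choose 2 : ℕ) : ℤ) = m.choose 2 + n.choose 2 + m * n := by
  induction n with
  | zero => simp
  | succ n ih =>
    have h1 := Nat.choose_succ_succ' (m + n) 1
    have h2 := Nat.choose_succ_succ' n 1
    rw [Nat.choose_one_right] at h1 h2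
    rw [← add_assoc, h1, h2]
    push_cast
    rw [ih]
    ring

/-- The parity identity behind the compatibility of the sign conventions with dualization. -/
theorem dual_signs_eq (a b c d e : ℕ) :
    (-1 : ℝ) ^ (((b : ℤ) + c - e) * (c + d) + (d + e) * c) *
        (-1 : ℝ) ^ (((a : ℤ) + b - (d + e)) * (d + e : ℕ) + (d + e).choose 2 + (a + b).choose 2) =
      (-1 : ℝ) ^ (((a : ℤ) - (c + d)) * (b + c - e)) *
        ((-1 : ℝ) ^ (((b : ℤ) + c - e) * e + e.choose 2 + (b + c).choose 2) *
          (-1 : ℝ) ^ (((a : ℤ) - (c + d)) * (c + d : ℕ) + (c + d).choose 2 + a.choose 2)) *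
        ((-1 : ℝ) ^ (b * c) * (-1 : ℝ) ^ (c * d) *
          (-1 : ℝ) ^ (((d : ℤ) + c - a) * (c + b) + (b + a) * c) *
          (-1 : ℝ) ^ (d * e) * (-1 : ℝ) ^ (a * b)) := by
  simp only [← zpow_natCast, ← zpow_add₀ (show (-1 : ℝ) ≠ 0 by norm_num)]
  refine neg_one_zpow_eq_of_even ?_
  simp only [choose_two_add]
  push_cast
  -- The witness is half the difference of the exponents. The binomials of `a`, `b`, `d`, `e`
  -- cancel, while that of `c` occurs twice on one side, as `Im δ` contributes to both `κ(D'')` and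
  -- `𝔠(D')`.
  exact ⟨-b * c + b * d + c * c + c * d - 2 * d * e + a * e - a * c - c * e - c.choose 2, by ring⟩

namespace ExactTriple

variable {X Y X' Y' X'' Y'' : Type*}
  [NormedAddCommGroup X] [NormedSpace ℝ X] [NormedAddCommGroup Y] [NormedSpace ℝ Y]
  [NormedAddCommGroup X'] [NormedSpace ℝ X'] [NormedAddCommGroup Y'] [NormedSpace ℝ Y']
  [NormedAddCommGroup X''] [NormedSpace ℝ X''] [NormedAddCommGroup Y''] [NormedSpace ℝ Y'']
  [CompleteSpace X] [CompleteSpace Y] [CompleteSpace X'] [CompleteSpace Y']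
  [CompleteSpace X''] [CompleteSpace Y'']
  {t : ExactTriple X Y X' Y' X'' Y''} {a b c d e : ℕ}

/-- The isomorphism `Ψ` of the dual triple on the generators given by dual bases. -/
theorem AdaptedBases.Psi_dual_basisWedge (β : t.AdaptedBases a b c d e)
    {α : Dual ℝ (TopExt (Coker (dualOp t.D'')))} {γ : Dual ℝ (TopExt (Coker (dualOp t.D')))}
    {ω : Dual ℝ (TopExt (Coker (dualOp t.D)))}
    (hα : α (basisWedge (cokerDualBasis t.fredholm'' β.ker'')) = 1)
    (hγ : γ (basisWedge (cokerDualBasis t.fredholm' β.ker')) = 1)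
    (hω : ω (basisWedge (cokerDualBasis t.fredholm β.ker)) = 1) :
    t.dual.Psi ((basisWedge (kerDualBasis t.fredholm'' β.coker'') ⊗ₜ α) ⊗ₜ
        (basisWedge (kerDualBasis t.fredholm' β.coker') ⊗ₜ γ)) =
      ((-1 : ℝ) ^ (b * c) * (-1 : ℝ) ^ (c * d) * (-1 : ℝ) ^ t.dual.signExp *
        (-1 : ℝ) ^ (d * e) * (-1 : ℝ) ^ (a * b)) •
        (basisWedge (kerDualBasis t.fredholm β.coker) ⊗ₜ[ℝ] ω) := by
  -- The functional normalised on the generator with exchanged blocks is `α` times the sign of the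
  -- exchange; the same applies to `ω` below.
  have h1 : (((-1 : ℝ) ^ (b * c)) • α) (basisWedge
      ((cokerDualBasis t.fredholm'' β.ker'').reindex finAddFlip)) = 1 := by
    rw [basisWedge_reindex_finAddFlip, map_smul, LinearMap.smul_apply, hα, smul_eq_mul,
      smul_eq_mul, mul_one, neg_one_pow_mul_self]
  have h2 : (((-1 : ℝ) ^ (a * b)) • ω) (basisWedge
      ((cokerDualBasis t.fredholm β.ker).reindex finAddFlip)) = 1 := by
    rw [basisWedge_reindex_finAddFlip, map_smul, LinearMap.smul_apply, hω, smul_eq_mul,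
      smul_eq_mul, mul_one, neg_one_pow_mul_self]
  exact map_fourfold_of_signs t.dual.Psi.toLinearMap (neg_one_pow_mul_self _)
    (neg_one_pow_mul_self _) (basisWedge_reindex_finAddFlip _) (basisWedge_reindex_finAddFlip _)
    (β.dual.Psi_basisWedge h1 hγ h2)

end ExactTriple

/-! ### Reduction to a single generator -/

section Lines

variable {A B C E A₁ B₁ C₁ E₁ G H M N : Type*} [AddCommMonoid A] [Module ℝ A] [AddCommMonoid B]
  [Module ℝ B] [AddCommMonoid C] [Module ℝ C] [AddCommMonoid E] [Module ℝ E] [AddCommMonoid A₁]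
  [Module ℝ A₁] [AddCommMonoid B₁] [Module ℝ B₁] [AddCommMonoid C₁] [Module ℝ C₁]
  [AddCommMonoid E₁] [Module ℝ E₁] [AddCommMonoid G] [Module ℝ G] [AddCommMonoid H] [Module ℝ H]
  [AddCommMonoid M] [Module ℝ M] [AddCommMonoid N] [Module ℝ N]

/-- A square of maps between products of lines commutes if it does so on generators. -/
theorem square_comm_of_generators (P : (A ⊗[ℝ] B) ⊗[ℝ] (C ⊗[ℝ] E) ≃ₗ[ℝ] G ⊗[ℝ] H)
    (Q : G ⊗[ℝ] H ≃ₗ[ℝ] M ⊗[ℝ] N) (S : (C₁ ⊗[ℝ] E₁) ⊗[ℝ] (A₁ ⊗[ℝ] B₁) ≃ₗ[ℝ] M ⊗[ℝ] N)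
    (T : C ⊗[ℝ] E ≃ₗ[ℝ] C₁ ⊗[ℝ] E₁) (T' : A ⊗[ℝ] B ≃ₗ[ℝ] A₁ ⊗[ℝ] B₁)
    (R : (A ⊗[ℝ] B) ⊗[ℝ] (C ⊗[ℝ] E) ≃ₗ[ℝ] (C ⊗[ℝ] E) ⊗[ℝ] (A ⊗[ℝ] B))
    {x : A} {y : B} {u : C} {v : E} {x₁ : A₁} {y₁ : B₁} {u₁ : C₁} {v₁ : E₁} {g : G} {h : H}
    {m : M} {n : N} {p q r s s' k : ℝ}
    (hx : ∀ w, ∃ c : ℝ, c • x = w) (hy : ∀ w, ∃ c : ℝ, c • y = w)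
    (hu : ∀ w, ∃ c : ℝ, c • u = w) (hv : ∀ w, ∃ c : ℝ, c • v = w)
    (hP : P ((x ⊗ₜ y) ⊗ₜ (u ⊗ₜ v)) = p • (g ⊗ₜ[ℝ] h)) (hQ : Q (g ⊗ₜ h) = q • (m ⊗ₜ[ℝ] n))
    (hR : R ((x ⊗ₜ y) ⊗ₜ (u ⊗ₜ v)) = r • ((u ⊗ₜ[ℝ] v) ⊗ₜ[ℝ] (x ⊗ₜ[ℝ] y)))
    (hT : T (u ⊗ₜ v) = s • (u₁ ⊗ₜ[ℝ] v₁)) (hT' : T' (x ⊗ₜ y) = s' • (x₁ ⊗ₜ[ℝ] y₁))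
    (hS : S ((u₁ ⊗ₜ v₁) ⊗ₜ (x₁ ⊗ₜ y₁)) = k • (m ⊗ₜ[ℝ] n)) (hsign : p * q = r * (s * s') * k)
    (z : (A ⊗[ℝ] B) ⊗[ℝ] (C ⊗[ℝ] E)) :
    Q (P z) = S (TensorProduct.congr T T' (R z)) := by
  have h0 : Q (P ((x ⊗ₜ y) ⊗ₜ (u ⊗ₜ v))) =
      S (TensorProduct.congr T T' (R ((x ⊗ₜ y) ⊗ₜ (u ⊗ₜ v)))) := by
    rw [hP, map_smul, hQ, hR, map_smul, TensorProduct.congr_tmul, hT, hT',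
      TensorProduct.smul_tmul_smul, map_smul, map_smul, hS, smul_smul, smul_smul, smul_smul,
      hsign, mul_assoc]
  have hFG : (P ≪≫ₗ Q).toLinearMap = (R ≪≫ₗ TensorProduct.congr T T' ≪≫ₗ S).toLinearMap := by
    -- Every pure tensor is a scalar multiple of the chosen one, and both maps are linear, so `h0`
    -- suffices.
    refine TensorProduct.ext_fourfold' fun x' y' u' v' => ?_
    obtain ⟨a, rfl⟩ := hx x'
    obtain ⟨b, rfl⟩ := hy y'
    obtain ⟨c, rfl⟩ := hu u'
    obtain ⟨d, rfl⟩ := hv v'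
    simp only [TensorProduct.tmul_smul, ← TensorProduct.smul_tmul', map_smul]
    rw [LinearEquiv.coe_coe, LinearEquiv.coe_coe, LinearEquiv.trans_apply,
      LinearEquiv.trans_apply, LinearEquiv.trans_apply, h0]
  exact LinearMap.congr_fun hFG z

end Lines

theorem basisWedge_generates {V : Type*} [AddCommGroup V] [Module ℝ V] [FiniteDimensional ℝ V]
    {n : ℕ} (b : Basis (Fin n) ℝ V) (w : TopExt V) : ∃ c : ℝ, c • basisWedge b = w :=
  (finrank_eq_one_iff_of_nonzero' _ (basisWedge_ne_zero b)).1 (finrank_topExt V) w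

theorem dual_generates {L : Type*} [AddCommGroup L] [Module ℝ L] (hL : finrank ℝ L = 1)
    {φ : Dual ℝ L} {x : L} (h : φ x = 1) (ψ : Dual ℝ L) : ∃ c : ℝ, c • φ = ψ := by
  refine ⟨ψ x, LinearMap.ext fun y => ?_⟩
  have hx : x ≠ 0 := fun h0 => by rw [h0, map_zero] at h; exact zero_ne_one h
  obtain ⟨c, rfl⟩ := (finrank_eq_one_iff_of_nonzero' x hx).1 hL y
  rw [LinearMap.smul_apply, map_smul, map_smul, h, smul_eq_mul, smul_eq_mul, smul_eq_mul, mul_one,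
    mul_comm]

/-! ### The proposition for a triple with adapted bases -/

section Main

variable {X Y X' Y' X'' Y'' : Type*}
  [NormedAddCommGroup X] [NormedSpace ℝ X] [NormedAddCommGroup Y] [NormedSpace ℝ Y]
  [NormedAddCommGroup X'] [NormedSpace ℝ X'] [NormedAddCommGroup Y'] [NormedSpace ℝ Y']
  [NormedAddCommGroup X''] [NormedSpace ℝ X''] [NormedAddCommGroup Y''] [NormedSpace ℝ Y'']
  [CompleteSpace X] [CompleteSpace Y] [CompleteSpace X'] [CompleteSpace Y']
  [CompleteSpace X''] [CompleteSpace Y'']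
  {t : ExactTriple X Y X' Y' X'' Y''} {a b c d e : ℕ}

/-- Indices and both exponents `ε` are expressed through the block sizes; for the dual triple these
are `e, d, c, b, a`. -/
theorem ExactTriple.AdaptedBases.dual_signs_eq (β : t.AdaptedBases a b c d e) :
    (-1 : ℝ) ^ t.signExp *
        (-1 : ℝ) ^ (index t.D * (d + e : ℕ) + (d + e).choose 2 + (a + b).choose 2) =
      (-1 : ℝ) ^ (index t.D' * index t.D'') *
        ((-1 : ℝ) ^ (index t.D'' * e + e.choose 2 + (b + c).choose 2) *
          (-1 : ℝ) ^ (index t.D' * (c + d : ℕ) + (c + d).choose 2 + a.choose 2)) *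
        ((-1 : ℝ) ^ (b * c) * (-1 : ℝ) ^ (c * d) * (-1 : ℝ) ^ t.dual.signExp *
          (-1 : ℝ) ^ (d * e) * (-1 : ℝ) ^ (a * b)) := by
  rw [β.signExp_eq, β.dual.signExp_eq, β.index_eq, β.index_eq', β.index_eq'']
  exact FredholmDet.dual_signs_eq a b c d e

theorem ExactTriple.AdaptedBases.dualization_Psi (β : t.AdaptedBases a b c d e)
    (z : DetLine t.D' ⊗[ℝ] DetLine t.D'') :
    dualization t.fredholm (t.Psi z) =
      t.dual.Psi (TensorProduct.congr (dualization t.fredholm'') (dualization t.fredholm')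
        (gradedSwap t.D' t.D'' z)) := by
  have : FiniteDimensional ℝ (Ker t.D') := t.fredholm'.finite_ker
  -- The six functionals are the elements `ℓ*` for the generators of the six cokernel lines, three
  -- for `t` and three for `t*`.
  refine (exists_dual_eq_one (basisWedge_ne_zero β.coker')).elim fun α hα => ?_
  refine (exists_dual_eq_one (basisWedge_ne_zero β.coker'')).elim fun γ hγ => ?_
  refine (exists_dual_eq_one (basisWedge_ne_zero β.coker)).elim fun ω hω => ?_
  refine (exists_dual_eq_one (basisWedge_ne_zero
    (cokerDualBasis t.fredholm'' β.ker''))).elim fun α₁ hα₁ => ?_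
  refine (exists_dual_eq_one (basisWedge_ne_zero
    (cokerDualBasis t.fredholm' β.ker'))).elim fun γ₁ hγ₁ => ?_
  refine (exists_dual_eq_one (basisWedge_ne_zero
    (cokerDualBasis t.fredholm β.ker))).elim fun ω₁ hω₁ => ?_
  have h1 := β.Psi_basisWedge hα hγ hω
  have h2 := dualization_basisWedge t.fredholm β.ker β.coker hω hω₁
  have h3 := gradedSwap_tmul t.D' t.D'' (basisWedge β.ker' ⊗ₜ α) (basisWedge β.ker'' ⊗ₜ γ)
  have h4 := dualization_basisWedge t.fredholm'' β.ker'' β.coker'' hγ hα₁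
  have h5 := dualization_basisWedge t.fredholm' β.ker' β.coker' hα hγ₁
  have h6 := β.Psi_dual_basisWedge hα₁ hγ₁ hω₁
  exact square_comm_of_generators t.Psi (dualization t.fredholm)
    t.dual.Psi (dualization t.fredholm'') (dualization t.fredholm')
    (gradedSwap t.D' t.D'') (basisWedge_generates β.ker')
    (dual_generates (finrank_topExt _) hα) (basisWedge_generates β.ker'')
    (dual_generates (finrank_topExt _) hγ) h1 h2 h3 h4 h5 h6 β.dual_signs_eq z

end Main

end FredholmDet

end

theorem mainTheorem6 {X Y X' Y' X'' Y'' : Type*}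
    [NormedAddCommGroup X] [NormedSpace ℝ X] [CompleteSpace X]
    [NormedAddCommGroup Y] [NormedSpace ℝ Y] [CompleteSpace Y]
    [NormedAddCommGroup X'] [NormedSpace ℝ X'] [CompleteSpace X']
    [NormedAddCommGroup Y'] [NormedSpace ℝ Y'] [CompleteSpace Y']
    [NormedAddCommGroup X''] [NormedSpace ℝ X''] [CompleteSpace X'']
    [NormedAddCommGroup Y''] [NormedSpace ℝ Y''] [CompleteSpace Y'']
    (t : FredholmDet.ExactTriple X Y X' Y' X'' Y'')
    (z : FredholmDet.DetLine t.D' ⊗[ℝ] FredholmDet.DetLine t.D'') :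
    FredholmDet.dualization t.fredholm (t.Psi z) =
      t.dual.Psi
        (TensorProduct.congr (FredholmDet.dualization t.fredholm'')
          (FredholmDet.dualization t.fredholm') (FredholmDet.gradedSwap t.D' t.D'' z)) := by
  exact t.exists_adaptedBases.elim fun a h => h.elim fun b h => h.elim fun c h => h.elim
    fun d h => h.elim fun e h => h.elim fun β => β.dualization_Psi z
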